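/- Consider the following decision problem. Given are a finite set $\mathit{Act}$ of actions containing an internal action $\tau$; a one-counter net $N=(Q,\mathit{Act},\delta)$ with finite $Q$ and $\delta\subseteq Q\times\mathit{Act}\times\{-1,0,1\}\times Q$, which induces the transition system on $Q\times\mathbb{N}$ with $pm\xrightarrow{a}p'm'$ iff $(p,a,d,p')\in\delta$ and $m'=m+d\ge 0$ for some $d$; a finite labelled transition system $F=(S,\mathit{Act},\to)$; a configuration $qm$ of $N$ and a state $s$ of $F$. Write $\Rightarrow^{\tau}$ for $(\xrightarrow{\tau})^*$ and $\Rightarrow^{a}$ for $(\xrightarrow{\tau})^*\cdot\xrightarrow{a}\cdot(\xrightarrow{\tau})^*$ if $a\ne\tau$. A relation $R\subseteq (Q\times\mathbb{N})\times S$ is a weak simulation if whenever $x\,R\,t$ and $x\xrightarrow{a}x'$ in the system of $N$, there is $t'$ with $t\Rightarrow^{a}t'$ in $F$ and $x'\,R\,t'$. The question is whether $s$ weakly simulates $qm$, i.e. whether some weak simulation contains $(qm,s)$. This problem is in $\mathsf{P}$: the language of the encodings of its positive instances is decided by a Turing machine in time polynomial in the length of the input, where the finite sets and transition relations are listed explicitly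 and the counter value $m$ is written in binary. -/

import Mathlib

/-! ### Labelled transition systems and weak simulation -/

/-- A labelled transition system with states `V` and action labels `Act`. -/
structure LTS (V Act : Type*) where
  /-- `step s a t` is the labelled transition `s --a--> t`. -/
  step : V → Act → V → Prop

namespace LTS

/-- The weak step relation, for the internal action `τ`: a weak `τ`-step is a finite (possibly
empty) sequence of `τ`-steps, and for `a ≠ τ` a weak `a`-step is one `a`-step with finite sequences
of `τ`-steps before and after it. -/
def WeakStep {V Act : Type*} (T : LTS V Act) (τ : Act) (s : V) (a : Act) (t : V) : Prop :=
  (a = τ ∧ Relation.ReflTransGen (fun x y => T.step x τ y) s t) ∨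
  (a ≠ τ ∧ ∃ s' t', Relation.ReflTransGen (fun x y => T.step x τ y) s s' ∧ T.step s' a t' ∧
    Relation.ReflTransGen (fun x y => T.step x τ y) t' t)

/-- `R` is a weak simulation between the states of `T₁` and those of `T₂`
(for a relation on one system take `T₁ = T₂`; for two systems this is a weak simulation
on their disjoint union): every strong step on the left is matched by a weak step on the right. -/
def IsWeakSimulation {V₁ V₂ Act : Type*} (T₁ : LTS V₁ Act) (T₂ : LTS V₂ Act) (τ : Act)
    (R : V₁ → V₂ → Prop) : Prop :=
  ∀ s t, R s t → ∀ a s', T₁.step s a s' → ∃ t', T₂.WeakStep τ t a t' ∧ R s' t'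

/-- Weak simulation preorder, the union of all weak simulations:
the process `t` of `T₂` weakly simulates the process `s` of `T₁`. -/
def WeaklySimulatedBy {V₁ V₂ Act : Type*} (T₁ : LTS V₁ Act) (T₂ : LTS V₂ Act) (τ : Act)
    (s : V₁) (t : V₂) : Prop :=
  ∃ R : V₁ → V₂ → Prop, IsWeakSimulation T₁ T₂ τ R ∧ R s t

end LTS

/-! ### One-counter nets -/

/-- A one-counter net with control states `Q` and actions `Act`, given by its transition relation
`δ ⊆ Q × Act × {-1, 0, 1} × Q` (there are no zero tests). -/
structure OneCounterNet (Q Act : Type*) where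
  /-- the transition relation -/
  δ : Set (Q × Act × SignType × Q)

/-- The transition system on `Q × ℕ` that a one-counter net induces. The type of the new counter
value `m'` makes it nonnegative. -/
def OneCounterNet.toLTS {Q Act : Type*} (N : OneCounterNet Q Act) : LTS (Q × ℕ) Act where
  step := fun (p, m) a (p', m') => ∃ d : SignType, (p, a, d, p') ∈ N.δ ∧ (m' : ℤ) = (m : ℤ) + (d : ℤ)

/-! ### Languages decidable in deterministic polynomial time -/

open Classical in
/-- The language `L` over a finite alphabet is in `P`: a (multi-stack) Turing machine decides,
for every word `w`, whether `w ∈ L`, in time polynomial in the length of `w`. -/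
def InP {Γ : Type} [Fintype Γ] (L : Language Γ) : Prop :=
  Nonempty (Turing.TM2ComputableInPolyTime (id : List Γ → List Γ) Computability.encodeBool
    (fun w : List Γ => decide (w ∈ L)))

/-! ### The decision problem -/

/-- An instance of the problem: a one-counter net and a finite-state system over the same finite
set of actions, a configuration of the net and a state of the finite system. The finite sets of
actions and of states are numbered; the internal action is number `0`. -/
structure WeakSimInstance where
  /-- number of actions other than the internal action `0` -/
  numVisible : ℕ
  /-- number of control states of the net -/
  numNet : ℕ
  /-- number of states of the finite system -/
  numFin : ℕ
  /-- initial control state of the net -/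
  netState : Fin numNet
  /-- initial counter value of the net -/
  counter : ℕ
  /-- initial state of the finite system -/
  finState : Fin numFin
  /-- the transitions of the net, as a list -/
  netTrans : List (Fin numNet × Fin (numVisible + 1) × SignType × Fin numNet)
  /-- the transitions of the finite system, as a list -/
  finTrans : List (Fin numFin × Fin (numVisible + 1) × Fin numFin)

namespace WeakSimInstance

open Computability (Γ' encodeNat)

/-- The one-counter net of an instance. -/
def net (I : WeakSimInstance) : OneCounterNet (Fin I.numNet) (Fin (I.numVisible + 1)) where
  δ := {t | t ∈ I.netTrans}

/-- The finite-state system of an instance. -/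
def finiteSystem (I : WeakSimInstance) : LTS (Fin I.numFin) (Fin (I.numVisible + 1)) where
  step := fun s a t => (s, a, t) ∈ I.finTrans

/-- The question: does the finite-state process weakly simulate the process of the net? -/
def Holds (I : WeakSimInstance) : Prop :=
  LTS.WeaklySimulatedBy I.net.toLTS I.finiteSystem 0 (I.netState, I.counter) I.finState

/-- Unary code, for the sizes and elements of the explicitly given finite sets. -/
def unaryCode (n : ℕ) : List Γ' :=
  List.replicate n (Γ'.bit true) ++ [Γ'.comma]

/-- Binary code (least significant bit first), for the counter value. -/
def binaryCode (n : ℕ) : List Γ' :=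
  (encodeNat n).map Γ'.bit ++ [Γ'.comma]

/-- Code of an effect in `{-1, 0, 1}`. -/
def effectCode : SignType → List Γ'
  | .neg => [Γ'.bit false]
  | .zero => [Γ'.comma]
  | .pos => [Γ'.bit true]

/-- Code of a list: every entry is preceded by an opening bracket, the list is terminated by a
closing bracket. -/
def listCode {α : Type} (c : α → List Γ') (l : List α) : List Γ' :=
  l.flatMap (fun x => Γ'.bra :: c x) ++ [Γ'.ket]

/-- Code of a transition of a net. -/
def netTransCode {n k : ℕ} (t : Fin n × Fin k × SignType × Fin n) : List Γ' :=
  unaryCode t.1 ++ (unaryCode t.2.1 ++ (effectCode t.2.2.1 ++ unaryCode t.2.2.2))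

/-- Code of a transition of a finite system. -/
def finTransCode {n k : ℕ} (t : Fin n × Fin k × Fin n) : List Γ' :=
  unaryCode t.1 ++ (unaryCode t.2.1 ++ unaryCode t.2.2)

/-- The word that presents an instance. -/
def encode (I : WeakSimInstance) : List Γ' :=
  unaryCode I.numVisible ++ (unaryCode I.numNet ++ (unaryCode I.numFin ++
    (unaryCode I.netState ++ (binaryCode I.counter ++ (unaryCode I.finState ++
      (listCode netTransCode I.netTrans ++ listCode finTransCode I.finTrans))))))

theorem unaryCode_append_inj {a b : ℕ} {u v : List Γ'}
    (h : unaryCode a ++ u = unaryCode b ++ v) : a = b ∧ u = v := by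
  induction a generalizing b with
  | zero =>
    cases b with
    | zero => simpa [unaryCode] using h
    | succ b => simp [unaryCode, List.replicate_succ] at h
  | succ a ih =>
    cases b with
    | zero => simp [unaryCode, List.replicate_succ] at h
    | succ b =>
      have h' : unaryCode a ++ u = unaryCode b ++ v := by
        simpa [unaryCode, List.replicate_succ] using h
      obtain ⟨h1, h2⟩ := ih h'
      exact ⟨by rw [h1], h2⟩

theorem unaryCode_fin_append_inj {n : ℕ} {a b : Fin n} {u v : List Γ'}
    (h : unaryCode a ++ u = unaryCode b ++ v) : a = b ∧ u = v :=
  ⟨Fin.ext (unaryCode_append_inj h).1, (unaryCode_append_inj h).2⟩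

theorem binaryCode_append_inj {a b : ℕ} {u v : List Γ'}
    (h : binaryCode a ++ u = binaryCode b ++ v) : a = b ∧ u = v := by
  have key : ∀ k l : List Bool, k.map Γ'.bit ++ ([Γ'.comma] ++ u) =
      l.map Γ'.bit ++ ([Γ'.comma] ++ v) → k = l ∧ u = v := by
    intro k
    induction k with
    | nil => intro l hl; cases l <;> simp_all
    | cons x k ih =>
      intro l hl
      cases l with
      | nil => simp at hl
      | cons y l =>
        simp only [List.map_cons, List.cons_append, List.cons.injEq, Γ'.bit.injEq] at hl
        obtain ⟨h1, h2⟩ := ih l hl.2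
        exact ⟨by rw [hl.1, h1], h2⟩
  simp only [binaryCode, List.append_assoc] at h
  obtain ⟨h1, h2⟩ := key _ _ h
  refine ⟨?_, h2⟩
  rw [← Computability.decode_encodeNat a, h1, Computability.decode_encodeNat]

theorem effectCode_append_inj {a b : SignType} {u v : List Γ'}
    (h : effectCode a ++ u = effectCode b ++ v) : a = b ∧ u = v := by
  cases a <;> cases b <;> simp_all [effectCode]

theorem listCode_append_inj {α : Type} {c : α → List Γ'}
    (hc : ∀ (x y : α) (u v : List Γ'), c x ++ u = c y ++ v → x = y ∧ u = v)
    {k l : List α} {u v : List Γ'}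
    (h : listCode c k ++ u = listCode c l ++ v) : k = l ∧ u = v := by
  induction k generalizing l with
  | nil => cases l <;> simp_all [listCode]
  | cons x k ih =>
    cases l with
    | nil => simp [listCode] at h
    | cons y l =>
      have h' : c x ++ (listCode c k ++ u) = c y ++ (listCode c l ++ v) := by
        simpa [listCode] using h
      obtain ⟨h1, h2⟩ := hc _ _ _ _ h'
      obtain ⟨h3, h4⟩ := ih h2
      exact ⟨by rw [h1, h3], h4⟩

/-- Different instances are presented by different words. -/
theorem encode_injective : Function.Injective encode := by
  rintro ⟨k, n, f, q, m, s, N, F⟩ ⟨k', n', f', q', m', s', N', F'⟩ h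
  simp only [encode] at h
  obtain ⟨rfl, h⟩ := unaryCode_append_inj h
  obtain ⟨rfl, h⟩ := unaryCode_append_inj h
  obtain ⟨rfl, h⟩ := unaryCode_append_inj h
  obtain ⟨hq, h⟩ := unaryCode_fin_append_inj h
  obtain ⟨hm, h⟩ := binaryCode_append_inj h
  obtain ⟨hs, h⟩ := unaryCode_fin_append_inj h
  obtain ⟨hN, h⟩ := listCode_append_inj (fun x y u v hxy => by
    simp only [netTransCode, List.append_assoc] at hxy
    obtain ⟨h1, hxy⟩ := unaryCode_fin_append_inj hxy
    obtain ⟨h2, hxy⟩ := unaryCode_fin_append_inj hxy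
    obtain ⟨h3, hxy⟩ := effectCode_append_inj hxy
    obtain ⟨h4, hxy⟩ := unaryCode_fin_append_inj hxy
    exact ⟨Prod.ext h1 (Prod.ext h2 (Prod.ext h3 h4)), hxy⟩) h
  rw [← List.append_nil (listCode finTransCode F),
    ← List.append_nil (listCode finTransCode F')] at h
  obtain ⟨hF, -⟩ := listCode_append_inj (fun x y u v hxy => by
    simp only [finTransCode, List.append_assoc] at hxy
    obtain ⟨h1, hxy⟩ := unaryCode_fin_append_inj hxy
    obtain ⟨h2, hxy⟩ := unaryCode_fin_append_inj hxy
    obtain ⟨h3, hxy⟩ := unaryCode_fin_append_inj hxy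
    exact ⟨Prod.ext h1 (Prod.ext h2 h3), hxy⟩) h
  subst hq hm hs hN hF
  rfl

/-- The decision problem as a language: the codes of the instances with a positive answer. -/
def problem : Language Γ' :=
  {w | ∃ I : WeakSimInstance, I.encode = w ∧ I.Holds}

end WeakSimInstance

/-! Weak simulation fails exactly when Spoiler wins the game in which he moves in the net and
Duplicator answers with weak steps of the finite system. Spoiler's winning region is a least fixed
point (`LTS.weaklySimulatedBy_iff`).

A net has no zero tests, so a larger counter can only help Spoiler. Each pair `(p, t)` that he wins
for some counter value therefore has a minimal winning value. Let `K = |Q| * |S|`. By pigeonhole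
some `v` among `1, ..., K + 1` is the minimal value of no pair. Then no minimal value exceeds `v`:
from a pair not won at `v`, Spoiler can play his strategy with one unit less, since as soon as it
reaches a pair won at `v`, that pair is also won at `v - 1` and the missing unit is not needed
(`OneCounterNet.CappedWins.of_gap`, `OneCounterNet.CappedWins.le_card`). So all minimal values are
at most `K`, and capping the counter at `K + 1` does not change the winner
(`OneCounterNet.spoilerWins_iff_cappedWins`). The gap argument is carried out inside the capped
game. That game has polynomially many positions and is solved by iterating its monotone rule; the
binary counter value is capped while it is read, so it never becomes large.

To get an actual Turing machine, structured stack programs are compiled to `TM2` machines, data are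
stored as prefix codes of binary trees, and `PolyTime` is shown to be closed under composition, case
distinction and those iterations whose intermediate results stay short. The usual reason for the
latter is that each round adds an amount governed by a quantity that does not grow
(`PolyTime.iterate_of_measure`). Folds, list functions, unary arithmetic and least fixed points
follow, and `PolyTime.inP` leads back to machines. Malformed inputs are rejected by parsing, writing
the parsed data again, and comparing. -/

/-! ### Structured stack programs -/

/-- Structured programs over a family of stacks. The tests read the top of a stack. -/
inductive StackProg {K : Type} (Γ : K → Type) : Type
  | push (k : K) (x : Γ k) : StackProg Γ
  | pop (k : K) : StackProg Γ
  | seq (P Q : StackProg Γ) : StackProg Γ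
  | ite (k : K) (p : Option (Γ k) → Bool) (P Q : StackProg Γ) : StackProg Γ
  | loop (k : K) (p : Option (Γ k) → Bool) (P : StackProg Γ) : StackProg Γ

namespace StackProg

open Turing

variable {K : Type} [DecidableEq K] {Γ : K → Type}

/-- `P.Run S S' t`: started with the stacks `S`, the program `P` ends with the stacks `S'` after
`t` steps. -/
inductive Run : StackProg Γ → (∀ k, List (Γ k)) → (∀ k, List (Γ k)) → ℕ → Prop
  | push {k x S} : Run (push k x) S (Function.update S k (x :: S k)) 1
  | pop {k S} : Run (pop k) S (Function.update S k (S k).tail) 1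
  | seq {P Q S S' S'' t u} : Run P S S' t → Run Q S' S'' u → Run (seq P Q) S S'' (t + u)
  | ite_true {k p P Q S S' t} : p (S k).head? = true → Run P S S' t →
      Run (ite k p P Q) S S' (t + 1)
  | ite_false {k p P Q S S' t} : p (S k).head? = false → Run Q S S' t →
      Run (ite k p P Q) S S' (t + 1)
  | loop_false {k p P S} : p (S k).head? = false → Run (loop k p P) S S 1
  | loop_true {k p P S S' S'' t u} : p (S k).head? = true → Run P S S' t →
      Run (loop k p P) S' S'' u → Run (loop k p P) S S'' (t + u + 1)

/-- The labels of the machine that executes a program. -/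
def Label : StackProg Γ → Type
  | push _ _ => Unit
  | pop _ => Unit
  | seq P Q => P.Label ⊕ Q.Label
  | ite _ _ P Q => Unit ⊕ (P.Label ⊕ Q.Label)
  | loop _ _ P => Unit ⊕ P.Label

/-- The label at which the execution of a program starts. -/
def entry : (P : StackProg Γ) → P.Label
  | push _ _ => ()
  | pop _ => ()
  | seq P _ => Sum.inl P.entry
  | ite _ _ _ _ => Sum.inl ()
  | loop _ _ _ => Sum.inl ()

noncomputable instance fintypeLabel : (P : StackProg Γ) → Fintype P.Label
  | push _ _ => inferInstanceAs (Fintype Unit)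
  | pop _ => inferInstanceAs (Fintype Unit)
  | seq P Q =>
    have := fintypeLabel P
    have := fintypeLabel Q
    inferInstanceAs (Fintype (P.Label ⊕ Q.Label))
  | ite _ _ P Q =>
    have := fintypeLabel P
    have := fintypeLabel Q
    inferInstanceAs (Fintype (Unit ⊕ (P.Label ⊕ Q.Label)))
  | loop _ _ P =>
    have := fintypeLabel P
    inferInstanceAs (Fintype (Unit ⊕ P.Label))

/-- A test of the top of a stack, followed by a jump. -/
def testStmt {L : Type} (k : K) (p : Option (Γ k) → Bool) (l l' : L) : TM2.Stmt Γ L Bool :=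
  -- Both branches leave the internal state `false`: the positive one resets it, the negative one is
  -- taken only if it is `false`. Hence the state is `false` at every label and runs need not
  -- mention it.
  .peek k (fun _ o => p o) (.branch id (.load (fun _ => false) (.goto fun _ => l))
    (.goto fun _ => l'))

/-- The statements that execute a program inside a machine with labels `L`; `e` places the labels
of the program and `x` is the label to continue with. -/
def stmts {L : Type} : (P : StackProg Γ) → (P.Label → L) → L → P.Label → TM2.Stmt Γ L Bool
  | push k a, _, x, _ => .push k (fun _ => a) (.goto fun _ => x)
  | pop k, _, x, _ => .pop k (fun v _ => v) (.goto fun _ => x)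
  | seq P Q, e, x, l => match l with
    | .inl l => P.stmts (fun l => e (.inl l)) (e (.inr Q.entry)) l
    | .inr l => Q.stmts (fun l => e (.inr l)) x l
  | ite k p P Q, e, x, l => match l with
    | .inl _ => testStmt k p (e (.inr (.inl P.entry))) (e (.inr (.inr Q.entry)))
    | .inr (.inl l) => P.stmts (fun l => e (.inr (.inl l))) x l
    | .inr (.inr l) => Q.stmts (fun l => e (.inr (.inr l))) x l
  | loop k p P, e, x, l => match l with
    | .inl _ => testStmt k p (e (.inr P.entry)) x
    | .inr l => P.stmts (fun l => e (.inr l)) (e (.inl ())) l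

/-- `t` steps of a machine lead from one configuration to another. -/
def StepsTo {L σ : Type} (M : L → TM2.Stmt Γ L σ) (a b : TM2.Cfg Γ L σ) (t : ℕ) : Prop :=
  (flip bind (TM2.step M))^[t] (some a) = some b

theorem StepsTo.trans {L σ : Type} {M : L → TM2.Stmt Γ L σ} {a b c : TM2.Cfg Γ L σ} {t u : ℕ}
    (h : StepsTo M a b t) (h' : StepsTo M b c u) : StepsTo M a c (t + u) := by
  unfold StepsTo at *
  rw [Nat.add_comm, Function.iterate_add_apply, h, h']

theorem stepsTo_one {L σ : Type} {M : L → TM2.Stmt Γ L σ} {a b : TM2.Cfg Γ L σ}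
    (h : TM2.step M a = some b) : StepsTo M a b 1 := h

theorem stepsTo_test {L : Type} {M : L → TM2.Stmt Γ L Bool} {l l₁ l₂ : L} {k : K}
    {p : Option (Γ k) → Bool} (h : M l = testStmt k p l₁ l₂) (S : ∀ k, List (Γ k)) :
    StepsTo M ⟨some l, false, S⟩ ⟨some (if p (S k).head? then l₁ else l₂), false, S⟩ 1 := by
  apply stepsTo_one
  cases hp : p (S k).head? <;> simp [TM2.step, h, testStmt, TM2.stepAux, hp]

/-- The statements of a program execute it. -/
theorem Run.stepsTo {P : StackProg Γ} {S S' : ∀ k, List (Γ k)} {t : ℕ} (h : P.Run S S' t) :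
    ∀ {L : Type} (M : L → TM2.Stmt Γ L Bool) (e : P.Label → L) (x : L),
      (∀ l, M (e l) = P.stmts e x l) →
      StepsTo M ⟨some (e P.entry), false, S⟩ ⟨some x, false, S'⟩ t := by
  -- The induction is on the run, not on the program, because a loop executes itself again. The
  -- placement `e` and the exit `x` stay arbitrary so that subprograms can be embedded in larger
  -- machines.
  induction h with
  | push =>
    intro L M e x hM
    exact stepsTo_one (by simp [TM2.step, hM, stmts])
  | pop =>
    intro L M e x hM
    exact stepsTo_one (by simp [TM2.step, hM, stmts])
  | @seq P Q S S' S'' t u _ _ ih ih' =>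
    intro L M e x hM
    exact (ih M (fun l => e (.inl l)) (e (.inr Q.entry)) fun l => hM (.inl l)).trans
      (ih' M (fun l => e (.inr l)) x fun l => hM (.inr l))
  | @ite_true k p P Q S S' t hp _ ih =>
    intro L M e x hM
    have h1 := stepsTo_test (hM (.inl ())) S
    rw [if_pos hp] at h1
    rw [Nat.add_comm]
    exact h1.trans (ih M (fun l => e (.inr (.inl l))) x fun l => hM (.inr (.inl l)))
  | @ite_false k p P Q S S' t hp _ ih =>
    intro L M e x hM
    have h1 := stepsTo_test (hM (.inl ())) S
    rw [hp] at h1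
    rw [Nat.add_comm]
    exact h1.trans (ih M (fun l => e (.inr (.inr l))) x fun l => hM (.inr (.inr l)))
  | @loop_false k p P S hp =>
    intro L M e x hM
    have h1 := stepsTo_test (hM (.inl ())) S
    rw [hp] at h1
    exact h1
  | @loop_true k p P S S' S'' t u hp _ _ ih ih' =>
    intro L M e x hM
    have h1 := stepsTo_test (hM (.inl ())) S
    rw [if_pos hp] at h1
    rw [Nat.add_comm]
    exact h1.trans ((ih M (fun l => e (.inr l)) (e (.inl ())) fun l => hM (.inr l)).trans
      (ih' M e x hM))

/-- The machine that executes a program and halts. -/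
def machine (P : StackProg Γ) : Option P.Label → TM2.Stmt Γ (Option P.Label) Bool
  | none => .halt
  | some l => P.stmts some none l

theorem Run.machine {P : StackProg Γ} {S S' : ∀ k, List (Γ k)} {t : ℕ} (h : P.Run S S' t) :
    StepsTo P.machine ⟨some (some P.entry), false, S⟩ ⟨none, false, S'⟩ (t + 1) :=
  (h.stepsTo P.machine some none fun _ => rfl).trans (stepsTo_one rfl)

/-- A program as a bundled machine. -/
noncomputable def toFinTM2 [Fintype K] (P : StackProg Γ) (k₀ k₁ : K) [Fintype (Γ k₀)] : FinTM2 where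
  K := K
  k₀ := k₀
  k₁ := k₁
  Γ := Γ
  Λ := Option P.Label
  main := some P.entry
  σ := Bool
  initialState := false
  m := P.machine

end StackProg

/-! ### Data as binary trees -/

/-- Binary trees, the universal data type of the programs. -/
inductive DataTree : Type
  | leaf : DataTree
  | node (x y : DataTree) : DataTree

namespace DataTree

/-- Prefix code of a tree. -/
def code : DataTree → List Bool
  | leaf => [false]
  | node x y => true :: (x.code ++ y.code)

/-- The tree that represents a natural number in unary. -/
def ofNat : ℕ → DataTree
  | 0 => leaf
  | n + 1 => node leaf (ofNat n)

/-- The tree that represents a list, given trees for the entries. -/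
def ofList {α : Type} (e : α → DataTree) : List α → DataTree
  | [] => leaf
  | x :: l => node (e x) (ofList e l)

end DataTree

/-- Representation of the elements of a type by trees. -/
class TreeEnc (α : Type) where
  /-- the tree that represents an element -/
  enc : α → DataTree

namespace TreeEnc

open Computability (Γ')

instance : TreeEnc Unit := ⟨fun _ => .leaf⟩
instance : TreeEnc ℕ := ⟨.ofNat⟩
instance : TreeEnc Bool := ⟨fun b => .ofNat b.toNat⟩
instance {α : Type} [TreeEnc α] : TreeEnc (List α) := ⟨.ofList enc⟩
instance {α β : Type} [TreeEnc α] [TreeEnc β] : TreeEnc (α × β) := ⟨fun x => .node (enc x.1) (enc x.2)⟩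

/-- The number that represents a symbol. -/
def symbolIndex : Γ' → ℕ
  | .blank => 0
  | .bit true => 1
  | .bit false => 2
  | .bra => 3
  | .ket => 4
  | .comma => 5

/-- The number that represents a sign. -/
def signIndex : SignType → ℕ
  | .zero => 0
  | .neg => 1
  | .pos => 2

instance : TreeEnc Γ' := ⟨fun x => .ofNat (symbolIndex x)⟩
instance : TreeEnc SignType := ⟨fun x => .ofNat (signIndex x)⟩

variable {α β : Type} [TreeEnc α] [TreeEnc β]

/-- The word that represents an element. -/
def code (x : α) : List Bool := (enc x).code

/-- The length of the word that represents an element. -/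
def size (x : α) : ℕ := (code x).length

theorem code_pair (x : α) (y : β) : code (x, y) = true :: (code x ++ code y) := rfl
theorem code_cons (x : α) (l : List α) : code (x :: l) = true :: (code x ++ code l) := rfl
theorem code_succ (n : ℕ) : code (n + 1) = true :: false :: code n := rfl

theorem size_pair (x : α) (y : β) : size (x, y) = size x + size y + 1 := by
  simp [size, code_pair]
theorem size_nil : size ([] : List α) = 1 := rfl
theorem size_cons (x : α) (l : List α) : size (x :: l) = size x + size l + 1 := by
  simp [size, code_cons]
theorem size_succ (n : ℕ) : size (n + 1) = size n + 2 := by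
  simp [size, code_succ]
theorem size_true : size true = 3 := rfl
theorem size_false : size false = 1 := rfl
theorem size_nat (n : ℕ) : size n = 2 * n + 1 := by
  induction n with
  | zero => rfl
  | succ n ih => rw [size_succ, ih]; ring

theorem size_bool_le (b : Bool) : size b ≤ 3 := by cases b <;> decide

theorem length_le_size (l : List α) : l.length ≤ size l := by
  induction l with
  | nil => simp
  | cons x l ih => rw [size_cons, List.length_cons]; omega

theorem size_le_of_sublist {l l' : List α} (h : l.Sublist l') : size l ≤ size l' := by
  induction h with
  | slnil => rfl
  | cons x _ ih => rw [size_cons]; omega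
  | cons_cons x _ ih => rw [size_cons, size_cons]; omega

end TreeEnc

/-! ### The stacks of the programs -/

/-- The names of the stacks: input, output, and four registers. -/
inductive StackName : Type
  | inp
  | out
  | reg (j : Fin 4)
  deriving DecidableEq, Fintype

/-- The alphabets of the stacks. -/
@[reducible] def StackSym : StackName → Type
  | .inp => Computability.Γ'
  | .out => Bool
  | .reg _ => Bool

namespace StackProg

open TreeEnc Computability

/-- Stack contents. -/
def st (i : List Γ') (o : List Bool) (m a b c : List Bool) : ∀ k, List (StackSym k)
  | .inp => i
  | .out => o
  | .reg 0 => m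
  | .reg 1 => a
  | .reg 2 => b
  | .reg 3 => c

section st

variable (i : List Γ') (o m a b c x : List Bool)

@[simp] theorem st_inp : st i o m a b c .inp = i := rfl
@[simp] theorem st_out : st i o m a b c .out = o := rfl
@[simp] theorem st_reg0 : st i o m a b c (.reg 0) = m := rfl
@[simp] theorem st_reg1 : st i o m a b c (.reg 1) = a := rfl
@[simp] theorem st_reg2 : st i o m a b c (.reg 2) = b := rfl
@[simp] theorem st_reg3 : st i o m a b c (.reg 3) = c := rfl

@[simp] theorem update_inp (y : List Γ') :
    Function.update (st i o m a b c) .inp y = st y o m a b c := by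
  funext k; rcases k with _ | _ | j
  · rfl
  · rfl
  · fin_cases j <;> rfl
@[simp] theorem update_out : Function.update (st i o m a b c) .out x = st i x m a b c := by
  funext k; rcases k with _ | _ | j
  · rfl
  · rfl
  · fin_cases j <;> rfl
@[simp] theorem update_reg0 : Function.update (st i o m a b c) (.reg 0) x = st i o x a b c := by
  funext k; rcases k with _ | _ | j
  · rfl
  · rfl
  · fin_cases j <;> rfl
@[simp] theorem update_reg1 : Function.update (st i o m a b c) (.reg 1) x = st i o m x b c := by
  funext k; rcases k with _ | _ | j
  · rfl
  · rfl
  · fin_cases j <;> rfl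
@[simp] theorem update_reg2 : Function.update (st i o m a b c) (.reg 2) x = st i o m a x c := by
  funext k; rcases k with _ | _ | j
  · rfl
  · rfl
  · fin_cases j <;> rfl
@[simp] theorem update_reg3 : Function.update (st i o m a b c) (.reg 3) x = st i o m a b x := by
  funext k; rcases k with _ | _ | j
  · rfl
  · rfl
  · fin_cases j <;> rfl

end st

theorem Run.congr {K : Type} [DecidableEq K] {Γ : K → Type} {P : StackProg Γ}
    {S S' S'' : ∀ k, List (Γ k)} {t t' : ℕ} (h : P.Run S S' t) (hS : S' = S'') (ht : t = t') :
    P.Run S S'' t' := hS ▸ ht ▸ h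

theorem run_push {k : StackName} {x : StackSym k} {S S' : ∀ k, List (StackSym k)}
    (h : Function.update S k (x :: S k) = S') : Run (push k x) S S' 1 := h ▸ .push

theorem run_pop {k : StackName} {S S' : ∀ k, List (StackSym k)}
    (h : Function.update S k (S k).tail = S') : Run (pop k) S S' 1 := h ▸ .pop

/-- Move one symbol between registers. -/
def move (j j' : Fin 4) : StackProg StackSym :=
  .ite (.reg j) (fun o => o = some true)
    (.seq (.pop (.reg j)) (.push (.reg j') true)) (.seq (.pop (.reg j)) (.push (.reg j') false))

theorem run_move {j j' : Fin 4} (h : j ≠ j') {S : ∀ k, List (StackSym k)} {x : Bool}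
    {r : List Bool} (hS : S (.reg j) = x :: r) :
    (move j j').Run S (Function.update (Function.update S (.reg j) r) (.reg j') (x :: S (.reg j')))
      3 := by
  have h' : StackName.reg j' ≠ StackName.reg j := by simpa using h.symm
  cases x
  · exact .ite_false (by rw [hS]; rfl) (.seq .pop (run_push (by
      rw [hS, Function.update_of_ne h' _ S]; rfl)))
  · exact .ite_true (by rw [hS]; rfl) (.seq .pop (run_push (by
      rw [hS, Function.update_of_ne h' _ S]; rfl)))

/-- Move the contents of one register to another one. -/
def pour (j j' : Fin 4) : StackProg StackSym := .loop (.reg j) (fun o => o.isSome) (move j j')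

theorem run_pour {j j' : Fin 4} (h : j ≠ j') (w : List Bool) :
    ∀ S : ∀ k, List (StackSym k), S (.reg j) = w →
    (pour j j').Run S (Function.update (Function.update S (.reg j) []) (.reg j')
      (w.reverse ++ S (.reg j'))) (4 * w.length + 1) := by
  have h' : StackName.reg j' ≠ StackName.reg j := by simpa using h.symm
  induction w with
  | nil =>
    intro S hS
    refine (Run.loop_false (by rw [hS]; rfl)).congr ?_ rfl
    have h0 : Function.update S (.reg j) [] = S := by rw [← hS]; simp
    simp [h0]
  | cons x w ih =>
    intro S hS
    refine (Run.loop_true (by rw [hS]; rfl) (run_move h hS) (ih _ ?_)).congr ?_ ?_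
    · rw [Function.update_of_ne h'.symm, Function.update_self]
    · simp [Function.update_comm h'.symm]
    · simp only [List.length_cons]; ring

/-- `P` leads from `S` to `S'` in at most `n` steps. -/
def RunIn {K : Type} [DecidableEq K] {Γ : K → Type} (P : StackProg Γ) (S S' : ∀ k, List (Γ k))
    (n : ℕ) : Prop := ∃ t ≤ n, P.Run S S' t

section RunIn

variable {K : Type} [DecidableEq K] {Γ : K → Type} {P Q : StackProg Γ}
  {S S' S'' : ∀ k, List (Γ k)} {n n' : ℕ}

theorem Run.runIn (h : P.Run S S' n) : P.RunIn S S' n := ⟨n, le_rfl, h⟩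

theorem RunIn.mono (h : P.RunIn S S' n) (hn : n ≤ n') : P.RunIn S S' n' :=
  let ⟨t, ht, h⟩ := h
  ⟨t, ht.trans hn, h⟩

theorem RunIn.congr (h : P.RunIn S S' n) (hS : S' = S'') (hn : n ≤ n') : P.RunIn S S'' n' :=
  hS ▸ h.mono hn

theorem RunIn.seq (h : P.RunIn S S' n) (h' : Q.RunIn S' S'' n') :
    (StackProg.seq P Q).RunIn S S'' (n + n') :=
  let ⟨t, ht, h⟩ := h
  let ⟨t', ht', h'⟩ := h'
  ⟨t + t', add_le_add ht ht', .seq h h'⟩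

theorem RunIn.ite_true {k : K} {p : Option (Γ k) → Bool} (hp : p (S k).head? = true)
    (h : P.RunIn S S' n) : (StackProg.ite k p P Q).RunIn S S' (n + 1) :=
  let ⟨t, ht, h⟩ := h
  ⟨t + 1, by omega, .ite_true hp h⟩

theorem RunIn.ite_false {k : K} {p : Option (Γ k) → Bool} (hp : p (S k).head? = false)
    (h : Q.RunIn S S' n) : (StackProg.ite k p P Q).RunIn S S' (n + 1) :=
  let ⟨t, ht, h⟩ := h
  ⟨t + 1, by omega, .ite_false hp h⟩

theorem RunIn.loop_false {k : K} {p : Option (Γ k) → Bool} (hp : p (S k).head? = false) :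
    (StackProg.loop k p P).RunIn S S 1 := (Run.loop_false hp).runIn

theorem RunIn.loop_true {k : K} {p : Option (Γ k) → Bool} (hp : p (S k).head? = true)
    (h : P.RunIn S S' n) (h' : (StackProg.loop k p P).RunIn S' S'' n') :
    (StackProg.loop k p P).RunIn S S'' (n + n' + 1) :=
  let ⟨t, ht, h⟩ := h
  let ⟨t', ht', h'⟩ := h'
  ⟨t + t' + 1, by omega, .loop_true hp h h'⟩

end RunIn

/-- The loop that moves terms from the main register to register 1, as many as register 3 says. -/
def takeLoop : StackProg StackSym :=
  .loop (.reg 3) (fun o => o.isSome)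
    (.ite (.reg 0) (fun o => o = some true)
      (.seq (.pop (.reg 0)) (.seq (.push (.reg 1) true) (.push (.reg 3) true)))
      (.seq (.pop (.reg 0)) (.seq (.push (.reg 1) false) (.pop (.reg 3)))))

/-- Register 3 counts the subtrees still to be read: a `node` replaces one pending subtree by two, a
`leaf` settles one. The claim is phrased with an arbitrary continuation of the loop, so that the two
subtrees of a node can be chained. Each symbol costs five steps. -/
theorem run_takeLoop (i : List Γ') (o b : List Bool) (d : DataTree) : ∀ (r a c S'' u),
    takeLoop.Run (st i o r (d.code.reverse ++ a) b c) S'' u →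
    takeLoop.Run (st i o (d.code ++ r) a b (true :: c)) S'' (u + 5 * d.code.length) := by
  induction d with
  | leaf =>
    intro r a c S'' u h
    refine (Run.loop_true rfl (S' := st i o r (false :: a) b c) (t := 4) ?_ h).congr rfl ?_
    · exact .ite_false rfl (.seq (t := 1) (run_pop (update_reg0 ..))
        (.seq (t := 1) (run_push (update_reg1 ..)) (run_pop (update_reg3 ..))))
    · simp [DataTree.code]; ring
  | node x y ihx ihy =>
    intro r a c S'' u h
    have h1 : takeLoop.Run (st i o (x.code ++ (y.code ++ r)) (true :: a) b (true :: true :: c)) S''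
        (u + 5 * y.code.length + 5 * x.code.length) := by
      apply ihx
      apply ihy
      simpa [DataTree.code] using h
    refine (Run.loop_true rfl (t := 4) ?_ h1).congr rfl ?_
    · exact .ite_true rfl (.seq (t := 1) (run_pop (by
          rw [update_reg0]; simp [DataTree.code]))
        (.seq (t := 1) (run_push (update_reg1 ..)) (run_push (update_reg3 ..))))
    · simp [DataTree.code]; ring

/-- Move the term on top of the main register to register 1. -/
def take : StackProg StackSym := .seq (.push (.reg 3) true) takeLoop

/-! ### Stack operations on tree codes -/

section terms

variable {α β : Type} [TreeEnc α] [TreeEnc β]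

theorem run_take (i : List Γ') (o r a b : List Bool) (x : α) :
    take.RunIn (st i o (code x ++ r) a b []) (st i o r ((code x).reverse ++ a) b [])
      (5 * size x + 2) := by
  have h := run_takeLoop i o b (enc x) r a [] _ 1 (.loop_false rfl)
  exact ((Run.seq (run_push (update_reg3 ..)) h).congr rfl rfl).runIn.mono (by
    change 1 + (1 + 5 * size x) ≤ _; omega)

/-- The stacks with a given main register. -/
abbrev mainOnly (m : List Bool) : ∀ k, List (StackSym k) := st [] [] m [] [] []

theorem runIn_pour {j j' : Fin 4} (h : j ≠ j') {S S' : ∀ k, List (StackSym k)}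
    (hS : Function.update (Function.update S (.reg j) []) (.reg j')
      ((S (.reg j)).reverse ++ S (.reg j')) = S') :
    (pour j j').RunIn S S' (4 * (S (.reg j)).length + 1) :=
  ((run_pour h _ S rfl).congr hS rfl).runIn

/-- Remove the term on top of the main register. -/
def drop : StackProg StackSym := .seq take (.loop (.reg 1) (fun o => o.isSome) (.pop (.reg 1)))

theorem run_clear (m w : List Bool) :
    Run (.loop (.reg 1) (fun o => o.isSome) (.pop (.reg 1))) (st [] [] m w [] []) (mainOnly m)
      (2 * w.length + 1) := by
  induction w with
  | nil => exact .loop_false rfl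
  | cons x w ih =>
    exact (Run.loop_true rfl (run_pop (update_reg1 ..)) ih).congr rfl (by simp; ring)

theorem run_drop (x : α) (r : List Bool) :
    drop.RunIn (mainOnly (code x ++ r)) (mainOnly r) (7 * size x + 3) :=
  ((run_take [] [] r [] [] x).seq (run_clear r _).runIn).mono (by simp [size]; omega)

/-- Exchange the two terms on top of the main register. -/
def swap : StackProg StackSym :=
  -- Every transfer reverses a word, so each term must make an even number of them: the first term
  -- makes four, through registers 1, 2 and 3, and the second makes two.
  .seq take (.seq (pour 1 2) (.seq take (.seq (pour 2 3) (.seq (pour 3 0) (pour 1 0)))))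

theorem run_swap (x : α) (y : β) (r : List Bool) :
    swap.RunIn (mainOnly (code x ++ (code y ++ r))) (mainOnly (code y ++ (code x ++ r)))
      (17 * size x + 9 * size y + 8) := by
  refine ((run_take [] [] _ [] [] x).seq ((runIn_pour (by decide)
    (S' := st [] [] (code y ++ r) [] (code x) []) (by simp)).seq
    ((run_take [] [] _ [] _ y).seq ((runIn_pour (by decide)
      (S' := st [] [] r (code y).reverse [] (code x).reverse) (by simp)).seq
      ((runIn_pour (by decide) (S' := st [] [] (code x ++ r) (code y).reverse [] []) (by simp)).seq
        (runIn_pour (by decide) (by simp))))))).mono ?_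
  simp [size]; omega

/-- Duplicate the term on top of the main register. -/
def dup : StackProg StackSym :=
  .seq take (.seq (.loop (.reg 1) (fun o => o.isSome)
    (.ite (.reg 1) (fun o => o = some true)
      (.seq (.pop (.reg 1)) (.seq (.push (.reg 0) true) (.push (.reg 2) true)))
      (.seq (.pop (.reg 1)) (.seq (.push (.reg 0) false) (.push (.reg 2) false)))))
    (.seq (pour 2 1) (pour 1 0)))

theorem run_dupLoop (w : List Bool) : ∀ m b,
    Run (.loop (.reg 1) (fun o => o.isSome)
    (.ite (.reg 1) (fun o => o = some true)
      (.seq (.pop (.reg 1)) (.seq (.push (.reg 0) true) (.push (.reg 2) true)))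
      (.seq (.pop (.reg 1)) (.seq (.push (.reg 0) false) (.push (.reg 2) false)))))
      (st [] [] m w b []) (st [] [] (w.reverse ++ m) [] (w.reverse ++ b) []) (5 * w.length + 1) := by
  induction w with
  | nil => intro m b; exact .loop_false rfl
  | cons x w ih =>
    intro m b
    refine (Run.loop_true rfl (t := 4) ?_ (ih (x :: m) (x :: b))).congr (by simp) (by simp; ring)
    cases x
    · exact .ite_false rfl (.seq (t := 1) (run_pop (update_reg1 ..))
        (.seq (t := 1) (run_push (update_reg0 ..)) (run_push (update_reg2 ..))))
    · exact .ite_true rfl (.seq (t := 1) (run_pop (update_reg1 ..))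
        (.seq (t := 1) (run_push (update_reg0 ..)) (run_push (update_reg2 ..))))

theorem run_dup (x : α) (r : List Bool) :
    dup.RunIn (mainOnly (code x ++ r)) (mainOnly (code x ++ (code x ++ r))) (18 * size x + 5) := by
  refine ((run_take [] [] _ [] [] x).seq ((run_dupLoop _ _ _).runIn.seq ((runIn_pour (by decide)
    (S' := st [] [] (code x ++ r) (code x).reverse [] []) (by simp)).seq
    (runIn_pour (by decide) (by simp))))).mono ?_
  simp [size]; omega

/-- Put a word on the main register. -/
def pushWord : List Bool → StackProg StackSym
  -- There is no empty program; a push undone by a pop replaces it.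
  | [] => .seq (.push (.reg 0) true) (.pop (.reg 0))
  | x :: w => .seq (pushWord w) (.push (.reg 0) x)

theorem run_pushWord (i : List Γ') (w m : List Bool) :
    (pushWord w).RunIn (st i [] m [] [] []) (st i [] (w ++ m) [] [] []) (w.length + 2) := by
  induction w with
  | nil => exact (RunIn.seq (run_push rfl).runIn (run_pop (by simp)).runIn).mono (by simp)
  | cons x w ih =>
    exact (ih.seq (run_push (by simp)).runIn).mono (by simp only [List.length_cons]; omega)

/-- Remove one symbol from the main register. -/
theorem run_popMain (x : Bool) (m : List Bool) :
    (StackProg.pop (.reg 0)).RunIn (mainOnly (x :: m)) (mainOnly m) 1 :=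
  (run_pop (by simp)).runIn

end terms

end StackProg

/-! ### Polynomial-time functions on tree codes -/

open TreeEnc StackProg Computability

theorem Polynomial.eval_le_eval_nat (p : Polynomial ℕ) {m n : ℕ} (h : m ≤ n) :
    p.eval m ≤ p.eval n := by
  rw [Polynomial.eval_eq_sum, Polynomial.eval_eq_sum]
  exact Finset.sum_le_sum fun i _ => Nat.mul_le_mul_left _ (Nat.pow_le_pow_left h i)

/-- A function on tree-encoded data is computed by a structured program in polynomial time. The
program replaces the term on top of the main register. -/
@[fun_prop]
def PolyTime {α β : Type} [TreeEnc α] [TreeEnc β] (f : α → β) : Prop :=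
  ∃ (P : StackProg StackSym) (p : Polynomial ℕ), ∀ x : α, size (f x) ≤ p.eval (size x) ∧
    ∀ r, P.RunIn (mainOnly (code x ++ r)) (mainOnly (code (f x) ++ r)) (p.eval (size x))

namespace PolyTime

variable {α β γ δ : Type} [TreeEnc α] [TreeEnc β] [TreeEnc γ] [TreeEnc δ]

/-- A function that does not change the code is computed by doing nothing. -/
theorem of_code_eq {f : α → β} (h : ∀ x, code (f x) = code x) : PolyTime f := by
  refine ⟨pushWord [], .X + 2, fun x => ⟨?_, fun r => ?_⟩⟩
  · simp [size, h]
  · rw [h]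
    exact (run_pushWord [] [] _).mono (by simp)

@[fun_prop]
theorem id : PolyTime (fun x : α => x) := of_code_eq fun _ => rfl

theorem comp {g : β → γ} {f : α → β} (hg : PolyTime g) (hf : PolyTime f) :
    PolyTime (fun x => g (f x)) := by
  obtain ⟨P, p, hP⟩ := hf
  obtain ⟨Q, q, hQ⟩ := hg
  refine ⟨.seq P Q, p + q.comp p, fun x => ?_⟩
  have h1 := q.eval_le_eval_nat (hP x).1
  simp only [Polynomial.eval_add, Polynomial.eval_comp]
  refine ⟨?_, fun r => ?_⟩
  · have := (hQ (f x)).1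
    omega
  · exact (((hP x).2 r).seq ((hQ (f x)).2 r)).mono (by omega)

@[fun_prop]
theorem const (b : β) : PolyTime (fun _ : α => b) := by
  refine ⟨.seq drop (pushWord (code b)), 7 * .X + Polynomial.C (size b + 5), fun x => ?_⟩
  simp only [Polynomial.eval_add, Polynomial.eval_mul, Polynomial.eval_X, Polynomial.eval_C,
    Polynomial.eval_ofNat]
  refine ⟨by omega, fun r => ?_⟩
  exact ((run_drop x r).seq (run_pushWord [] (code b) r)).mono (by simp only [size]; omega)

@[fun_prop]
theorem pair {f : α → β} {g : α → γ} (hf : PolyTime f) (hg : PolyTime g) :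
    PolyTime (fun x => (f x, g x)) := by
  obtain ⟨P, p, hP⟩ := hf
  obtain ⟨Q, q, hQ⟩ := hg
  -- The second component is computed first, so that the first one ends up on top; the final push
  -- adds the node mark of the pair.
  refine ⟨.seq dup (.seq Q (.seq swap (.seq P (.push (.reg 0) true)))),
    27 * .X + p + 18 * q + 14, fun x => ?_⟩
  have h1 := (hP x).1
  have h2 := (hQ x).1
  simp only [Polynomial.eval_add, Polynomial.eval_mul, Polynomial.eval_X, Polynomial.eval_ofNat]
  refine ⟨by rw [size_pair]; omega, fun r => ?_⟩
  exact ((run_dup x r).seq (((hQ x).2 _).seq ((run_swap _ _ _).seq (((hP x).2 _).seq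
    (run_push (by simp [code_pair])).runIn)))).mono (by omega)

theorem cond {b : α → Bool} {f g : α → β} (hb : PolyTime b) (hf : PolyTime f) (hg : PolyTime g) :
    PolyTime (fun x => if b x = true then f x else g x) := by
  obtain ⟨B, _, hB⟩ := hb
  obtain ⟨P, p, hP⟩ := hf
  obtain ⟨Q, q, hQ⟩ := hg
  rename_i o
  refine ⟨.seq dup (.seq B (.ite (.reg 0) (fun o => o = some true)
    -- The code of `true` has three symbols and that of `false` one; the first symbol tells them
    -- apart.
    (.seq (.pop (.reg 0)) (.seq (.pop (.reg 0)) (.seq (.pop (.reg 0)) P)))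
    (.seq (.pop (.reg 0)) Q))), 18 * .X + o + p + q + 9, fun x => ?_⟩
  have h1 := (hP x).1
  have h2 := (hQ x).1
  simp only [Polynomial.eval_add, Polynomial.eval_mul, Polynomial.eval_X, Polynomial.eval_ofNat]
  refine ⟨by split_ifs <;> omega, fun r => ?_⟩
  have h3 := (run_dup x r).seq ((hB x).2 _)
  cases h : b x
  · refine ((run_dup x r).seq (((hB x).2 _).seq (.ite_false ?_ (.seq
      (S' := mainOnly (code x ++ r)) ?_ ((hQ x).2 r))))).mono (n := _ + (_ + (1 + _ + 1))) ?_
    · rw [h]; rfl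
    · rw [h]; exact run_popMain _ _
    · omega
  · refine ((run_dup x r).seq (((hB x).2 _).seq (.ite_true ?_ (.seq
      (S' := mainOnly (false :: false :: (code x ++ r))) ?_ ((run_popMain _ _).seq
      ((run_popMain _ _).seq ((hP x).2 r))))))).mono (n := _ + (_ + (1 + (_ + (_ + _)) + 1))) ?_
    · rw [h]; rfl
    · rw [h]; exact run_popMain _ _
    · omega

/-- Case distinction on a list. -/
theorem casesList {l : α → List γ} {f : α → β} {g : α × (γ × List γ) → β} {k : α → β}
    (hl : PolyTime l) (hf : PolyTime f) (hg : PolyTime g) (h0 : ∀ x, l x = [] → k x = f x)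
    (h1 : ∀ x y m, l x = y :: m → k x = g (x, (y, m))) : PolyTime k := by
  obtain ⟨B, o, hB⟩ := hl
  obtain ⟨P, p, hP⟩ := hf
  obtain ⟨Q, q, hQ⟩ := hg
  refine ⟨.seq dup (.seq B (.ite (.reg 0) (fun o => o = some true)
    -- The code of `y :: m` is also the code of the pair `(y, m)`, so after the swap a single node
    -- mark completes the code of `(x, (y, m))`.
    (.seq swap (.seq (.push (.reg 0) true) Q)) (.seq (.pop (.reg 0)) P))),
    27 * .X + 18 * o + p + q.comp (.X + o + 1) + 16, fun x => ?_⟩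
  simp only [Polynomial.eval_add, Polynomial.eval_mul, Polynomial.eval_X, Polynomial.eval_ofNat,
    Polynomial.eval_comp, Polynomial.eval_one]
  have h3 := (hB x).1
  rcases h : l x with _ | ⟨y, m⟩
  · have h2 := (hP x).1
    rw [h0 x h]
    refine ⟨by omega, fun r => ?_⟩
    refine ((run_dup x r).seq (((hB x).2 _).seq (.ite_false ?_ (.seq
      (S' := mainOnly (code x ++ r)) ?_ ((hP x).2 r))))).mono (n := _ + (_ + (1 + _ + 1))) ?_
    · rw [h]; rfl
    · rw [h]; exact run_popMain _ _
    · omega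
  · have h4 := q.eval_le_eval_nat (m := size (x, (y, m)))
      (n := size x + o.eval (size x) + 1) (by
        rw [h, size_cons] at h3; rw [size_pair, size_pair]; omega)
    have h2 := (hQ (x, (y, m))).1
    rw [h1 x y m h]
    refine ⟨by omega, fun r => ?_⟩
    refine ((run_dup x r).seq (((hB x).2 _).seq (.ite_true ?_ (.seq
      (S' := mainOnly (code x ++ (code (l x) ++ r))) (run_swap _ _ _) (.seq
      (run_push (S' := mainOnly (code (x, (y, m)) ++ r)) ?_).runIn ((hQ _).2 r)))))).mono ?_
    · rw [h]; rfl
    · rw [h]; simp [code_pair, code_cons]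
    · omega

/-- The loop of an iteration. -/
theorem run_iterLoop {f : β → β} {P : StackProg StackSym} {p : Polynomial ℕ}
    (hP : ∀ x : β, size (f x) ≤ p.eval (size x) ∧
      ∀ r, P.RunIn (mainOnly (code x ++ r)) (mainOnly (code (f x) ++ r)) (p.eval (size x)))
    (A B : ℕ) (l : List γ) : ∀ (y : β) (r : List Bool), size l ≤ A →
      (∀ i ≤ l.length, size (f^[i] y) ≤ B) →
      RunIn (.loop (.reg 0) (fun o => o = some true) (.seq (.pop (.reg 0)) (.seq drop (.seq swap
        (.seq P swap))))) (mainOnly (code l ++ (code y ++ r)))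
        (mainOnly (false :: (code (f^[l.length] y) ++ r)))
        -- The list is only a counter: a round removes its head, swaps the value to the top, applies
        -- `P` and swaps back. The coefficients add up the costs of `drop` and of the two swaps.
        (l.length * (33 * A + 26 * B + p.eval B + 21) + 1) := by
  induction l with
  | nil => exact fun y r _ _ => (RunIn.loop_false rfl).mono (by omega)
  | cons a l ih =>
    intro y r hl hy
    have hb0 := hy 0 (by simp)
    have hb1 := hy 1 (by simp)
    simp only [Function.iterate_zero_apply, Function.iterate_one] at hb0 hb1
    rw [size_cons] at hl
    have hp := p.eval_le_eval_nat hb0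
    have h := ih (f y) r (by omega) (fun i hi => by
      have := hy (i + 1) (by simpa using hi)
      rwa [Function.iterate_succ_apply] at this)
    have h' := run_drop a (code l ++ (code y ++ r))
    rw [← List.append_assoc] at h'
    refine (RunIn.loop_true rfl ((run_popMain _ _).seq (.seq h'
      ((run_swap _ _ r).seq (((hP _).2 _).seq (run_swap _ _ r))))) h).mono ?_
    rw [List.length_cons, Nat.add_mul]; omega

/-- Iteration, as often as a list is long, if the intermediate results are short. -/
theorem iterate {l : α → List γ} {g : α → β} {f : β → β} (hl : PolyTime l) (hg : PolyTime g)
    (hf : PolyTime f) (B : Polynomial ℕ)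
    -- Without such a bound the size could double in every round and become exponential.
    (hB : ∀ x, ∀ i ≤ (l x).length, size (f^[i] (g x)) ≤ B.eval (size x)) :
    PolyTime (fun x => f^[(l x).length] (g x)) := by
  obtain ⟨P, p, hP⟩ := hf
  obtain ⟨L, o, hL⟩ := hl
  obtain ⟨Q, q, hQ⟩ := hg
  refine ⟨.seq dup (.seq Q (.seq swap (.seq L (.seq (.loop (.reg 0) (fun o => o = some true)
    (.seq (.pop (.reg 0)) (.seq drop (.seq swap (.seq P swap))))) (.pop (.reg 0)))))),
    27 * .X + o + 18 * q + 15 + B + o * (33 * o + 26 * B + p.comp B + 21), fun x => ?_⟩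
  simp only [Polynomial.eval_add, Polynomial.eval_mul, Polynomial.eval_X, Polynomial.eval_ofNat,
    Polynomial.eval_comp]
  have h1 := hB x _ le_rfl
  have h2 := (hQ x).1
  have h3 := (hL x).1
  refine ⟨by omega, fun r => ?_⟩
  have h4 := Nat.mul_le_mul_right
    (33 * o.eval (size x) + 26 * B.eval (size x) + p.eval (B.eval (size x)) + 21)
    ((length_le_size (l x)).trans h3)
  exact ((run_dup x r).seq (((hQ x).2 _).seq ((run_swap _ _ _).seq (((hL x).2 _).seq
    ((run_iterLoop hP _ _ (l x) (g x) r h3 (hB x)).seq (run_popMain _ _)))))).mono (by omega)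

@[fun_prop]
theorem fst' {f : α → β × γ} (hf : PolyTime f) : PolyTime (fun x => (f x).1) := by
  refine comp (g := Prod.fst) ⟨.seq (.pop (.reg 0)) (.seq swap drop), 33 * .X + 12, fun x => ?_⟩ hf
  simp only [Polynomial.eval_add, Polynomial.eval_mul, Polynomial.eval_X, Polynomial.eval_ofNat]
  obtain ⟨x, y⟩ := x
  rw [size_pair]
  refine ⟨by dsimp only; omega, fun r => ?_⟩
  refine (RunIn.seq (run_popMain _ _) ((RunIn.seq ?_ (run_drop y _)))).mono
    (n := 1 + (17 * size x + 9 * size y + 8 + _)) (by omega)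
  have := run_swap x y r
  simpa [code] using this

@[fun_prop]
theorem snd' {f : α → β × γ} (hf : PolyTime f) : PolyTime (fun x => (f x).2) := by
  refine comp (g := Prod.snd) ⟨.seq (.pop (.reg 0)) drop, 7 * .X + 4, fun x => ?_⟩ hf
  simp only [Polynomial.eval_add, Polynomial.eval_mul, Polynomial.eval_X, Polynomial.eval_ofNat]
  obtain ⟨x, y⟩ := x
  rw [size_pair]
  refine ⟨by dsimp only; omega, fun r => ?_⟩
  refine (RunIn.seq (run_popMain _ _) (n' := 7 * size x + 3) ?_).mono (by omega)
  have := run_drop x (code y ++ r)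
  simpa [code] using this

@[fun_prop]
theorem cons {f : α → β} {g : α → List β} (hf : PolyTime f) (hg : PolyTime g) :
    PolyTime (fun x => f x :: g x) :=
  comp (g := fun y : β × List β => y.1 :: y.2) (of_code_eq fun _ => rfl) (hf.pair hg)

end PolyTime

/-- Equality test. -/
def eqb {α : Type} [DecidableEq α] (a b : α) : Bool := decide (a = b)

@[simp] theorem eqb_iff {α : Type} [DecidableEq α] {a b : α} : eqb a b = true ↔ a = b := by
  simp [eqb]

/-- Since a number and a list of that many units have the same code, list programs perform unary
arithmetic at no cost of conversion. -/
theorem TreeEnc.code_replicate (n : ℕ) : code (List.replicate n ()) = code n := by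
  induction n with
  | zero => rfl
  | succ n ih => rw [List.replicate_succ, code_cons, code_succ, ih]; rfl

theorem TreeEnc.code_length_unit (l : List Unit) : code l.length = code l := by
  rw [← code_replicate, ← List.eq_replicate_length.2 fun _ _ => rfl]

theorem TreeEnc.symbolIndex_injective : Function.Injective symbolIndex := by
  intro a b h
  rcases a with _ | (_ | _) | _ | _ | _ <;> rcases b with _ | (_ | _) | _ | _ | _ <;>
    simp_all [symbolIndex]

theorem TreeEnc.signIndex_injective : Function.Injective signIndex := by
  intro a b h
  cases a <;> cases b <;> simp_all [signIndex]

namespace PolyTime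

/-- One step of a left fold over a list that is part of the data. -/
def foldStep {α β γ : Type} (f : α → β → γ → β) (s : α × List γ × β) : α × List γ × β :=
  match s.2.1 with
  | [] => s
  | a :: m => (s.1, m, f s.1 s.2.2 a)

theorem foldStep_iterate {α β γ : Type} (f : α → β → γ → β) (x : α) (l : List γ) (b : β) :
    (foldStep f)^[l.length] (x, l, b) = (x, [], l.foldl (f x) b) := by
  induction l generalizing b with
  | nil => rfl
  | cons a l ih => rw [List.length_cons, Function.iterate_succ_apply]; exact ih _

variable {α β γ δ : Type} [TreeEnc α] [TreeEnc β] [TreeEnc γ] [TreeEnc δ]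

/-! ### Booleans -/

@[fun_prop]
theorem cond' {b : α → Bool} {f g : α → β} (hb : PolyTime b) (hf : PolyTime f) (hg : PolyTime g) :
    PolyTime (fun x => bif b x then f x else g x) := by
  convert hb.cond hf hg using 2 with x
  cases b x <;> rfl

@[fun_prop]
theorem or {f g : α → Bool} (hf : PolyTime f) (hg : PolyTime g) :
    PolyTime (fun x => f x || g x) := by
  convert hf.cond (const true) hg using 2 with x
  cases f x <;> rfl

@[fun_prop]
theorem and {f g : α → Bool} (hf : PolyTime f) (hg : PolyTime g) :
    PolyTime (fun x => f x && g x) := by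
  convert hf.cond hg (const false) using 2 with x
  cases f x <;> rfl

@[fun_prop]
theorem not {f : α → Bool} (hf : PolyTime f) : PolyTime (fun x => !f x) := by
  convert hf.cond (const false) (const true) using 2 with x
  cases f x <;> rfl

/-! ### Iteration and folds -/

/-- Iteration of a step that enlarges the data by an amount that depends on a part of them that
does not grow. -/
theorem iterate_of_measure {l : α → List γ} {g : α → β} {f : β → β} (hl : PolyTime l)
    (hg : PolyTime g) (hf : PolyTime f) (μ : β → ℕ) (q : Polynomial ℕ) (h1 : ∀ y, μ y ≤ size y)
    (h2 : ∀ y, μ (f y) ≤ μ y) (h3 : ∀ y, size (f y) ≤ size y + q.eval (μ y)) :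
    PolyTime (fun x => f^[(l x).length] (g x)) := by
  -- As `μ` does not grow, every round adds at most the value of `q` at the initial measure, so the
  -- growth is linear in the number of rounds.
  have key : ∀ i y, μ (f^[i] y) ≤ μ y ∧ size (f^[i] y) ≤ size y + i * q.eval (μ y) := by
    intro i y
    induction i with
    | zero => simp
    | succ i ih =>
      rw [Function.iterate_succ_apply']
      refine ⟨(h2 _).trans ih.1, (h3 _).trans ?_⟩
      have := q.eval_le_eval_nat ih.1
      rw [Nat.add_mul]; omega
  have ⟨_, o, ho⟩ := hl
  have ⟨_, p, hp⟩ := hg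
  refine hl.iterate hg hf (p + o * q.comp p) fun x i hi => ((key i _).2).trans ?_
  simp only [Polynomial.eval_add, Polynomial.eval_mul, Polynomial.eval_comp]
  exact add_le_add (hp x).1 (Nat.mul_le_mul (hi.trans ((length_le_size _).trans (ho x).1))
    (q.eval_le_eval_nat ((h1 _).trans (hp x).1)))

/-- The fold is an iteration of `foldStep`, which carries the context and the unread list along. The
sizes of these two form the measure; the accumulator may grow only additively, by an amount that
depends on the context and the current entry. -/
theorem foldl {l : α → List γ} {g : α → β} {f : α → β → γ → β} (hl : PolyTime l) (hg : PolyTime g)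
    (hf : PolyTime fun y : α × β × γ => f y.1 y.2.1 y.2.2) (q : Polynomial ℕ)
    (hq : ∀ x b a, size (f x b a) ≤ size b + q.eval (size x + size a)) :
    PolyTime fun x => (l x).foldl (f x) (g x) := by
  have hs : PolyTime (foldStep f) := by
    refine casesList (l := fun s => s.2.1) (f := fun s => s)
      (g := fun t => (t.1.1, t.2.2, f t.1.1 t.1.2.2 t.2.1)) (by fun_prop) (by fun_prop) ?_ ?_ ?_
    · exact .pair (by fun_prop) (.pair (by fun_prop)
        (hf.comp (f := fun t : (α × List γ × β) × (γ × List γ) => (t.1.1, t.1.2.2, t.2.1))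
          (by fun_prop)))
    · intro s hs; simp [foldStep, hs]
    · intro s a m hs; simp [foldStep, hs]
  have h := iterate_of_measure (g := fun x => (x, l x, g x)) hl (by fun_prop) hs
    (fun s => size s.1 + size s.2.1) q ?_ ?_ ?_
  · have h' : PolyTime fun x => ((foldStep f)^[(l x).length] (x, l x, g x)).2.2 := by fun_prop
    simpa only [foldStep_iterate] using h'
  · rintro ⟨x, m, b⟩
    simp only [size_pair]; omega
  · rintro ⟨x, _ | ⟨a, m⟩, b⟩
    · exact le_rfl
    · simp only [foldStep, size_cons]; omega
  · rintro ⟨x, _ | ⟨a, m⟩, b⟩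
    · exact Nat.le_add_right _ _
    · have h := hq x b a
      have h' := q.eval_le_eval_nat (m := size x + size a) (n := size x + size (a :: m)) (by
        rw [size_cons]; omega)
      simp only [foldStep, size_pair, size_cons] at *; omega

/-! ### Lists -/

@[fun_prop]
theorem reverse {l : α → List β} (hl : PolyTime l) : PolyTime fun x => (l x).reverse := by
  have h := foldl (f := fun (_ : α) (b : List β) a => a :: b) hl (const []) (by fun_prop) (.X + 1)
    (fun x b a => by simp [size_cons]; omega)
  convert h using 2 with x
  simp

@[fun_prop]
theorem append {l m : α → List β} (hl : PolyTime l) (hm : PolyTime m) :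
    PolyTime fun x => l x ++ m x := by
  have h := foldl (f := fun (_ : α) (b : List β) a => a :: b) hl.reverse hm (by fun_prop) (.X + 1)
    (fun x b a => by simp [size_cons]; omega)
  convert h using 2 with x
  simp

theorem _root_.TreeEnc.size_append (l m : List β) : size (l ++ m) + 1 = size l + size m := by
  induction l with
  | nil => simp [size_nil]; omega
  | cons a l ih => rw [List.cons_append, size_cons, size_cons]; omega

@[fun_prop]
theorem flatMap {l : α → List γ} {f : α → γ → List β} (hl : PolyTime l)
    (hf : PolyTime fun y : α × γ => f y.1 y.2) : PolyTime fun x => (l x).flatMap (f x) := by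
  have ⟨_, p, hp⟩ := hf
  have h := foldl (f := fun x (b : List β) a => b ++ f x a) hl (const [])
    (.append (by fun_prop) (hf.comp (f := fun y : α × List β × γ => (y.1, y.2.2)) (by fun_prop)))
    (p.comp (.X + 1)) (fun x b a => by
      have h1 := (hp (x, a)).1
      have h2 := size_append b (f x a)
      simp only [size_pair] at h1
      simp only [Polynomial.eval_comp, Polynomial.eval_add, Polynomial.eval_X,
        Polynomial.eval_one] at *
      omega)
  have key : ∀ x (m : List γ) (b : List β),
      m.foldl (fun b a => b ++ f x a) b = b ++ m.flatMap (f x) := by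
    intro x m
    induction m with
    | nil => simp
    | cons a m ih => intro b; rw [List.foldl_cons, ih]; simp
  simpa only [key, List.nil_append] using h

@[fun_prop]
theorem map {l : α → List γ} {f : α → γ → β} (hl : PolyTime l)
    (hf : PolyTime fun y : α × γ => f y.1 y.2) : PolyTime fun x => (l x).map (f x) := by
  have h : PolyTime fun x => (l x).flatMap fun a => [f x a] := by fun_prop
  simpa only [← List.map_eq_flatMap] using h

@[fun_prop]
theorem filter {l : α → List β} {p : α → β → Bool} (hl : PolyTime l)
    (hp : PolyTime fun y : α × β => p y.1 y.2) : PolyTime fun x => (l x).filter (p x) := by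
  have h : PolyTime fun x => (l x).flatMap fun a => bif p x a then [a] else [] := by fun_prop
  convert h using 2 with x
  induction l x with
  | nil => rfl
  | cons a m ih => cases h : p x a <;> simp [h, ih]

@[fun_prop]
theorem any {l : α → List γ} {p : α → γ → Bool} (hl : PolyTime l)
    (hp : PolyTime fun y : α × γ => p y.1 y.2) : PolyTime fun x => (l x).any (p x) := by
  have h := foldl (f := fun x (b : Bool) a => b || p x a) hl (const false)
    (.or (by fun_prop) (hp.comp (f := fun y : α × Bool × γ => (y.1, y.2.2)) (by fun_prop)))
    (.C 3) (fun x b a => by rw [Polynomial.eval_C]; exact (size_bool_le _).trans (by omega))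
  have key : ∀ x (m : List γ) (b : Bool), m.foldl (fun b a => b || p x a) b = (b || m.any (p x)) := by
    intro x m
    induction m with
    | nil => simp
    | cons a m ih => intro b; rw [List.foldl_cons, ih]; simp [Bool.or_assoc]
  simpa only [key, Bool.false_or] using h

@[fun_prop]
theorem all {l : α → List γ} {p : α → γ → Bool} (hl : PolyTime l)
    (hp : PolyTime fun y : α × γ => p y.1 y.2) : PolyTime fun x => (l x).all (p x) := by
  have h : PolyTime fun x => !(l x).any fun a => !p x a := by fun_prop
  convert h using 2 with x
  simp [List.all_eq_not_any_not]

@[fun_prop]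
theorem tail {l : α → List β} (hl : PolyTime l) : PolyTime fun x => (l x).tail :=
  casesList (g := fun t => t.2.2) hl (const []) (by fun_prop) (fun x h => by simp [h])
    (fun x a m h => by simp [h])

@[fun_prop]
theorem headD {l : α → List β} {b : α → β} (hl : PolyTime l) (hb : PolyTime b) :
    PolyTime fun x => (l x).headD (b x) :=
  casesList (g := fun t => t.2.1) hl hb (by fun_prop) (fun x h => by simp [h])
    (fun x a m h => by simp [h])

@[fun_prop]
theorem isEmpty {l : α → List β} (hl : PolyTime l) : PolyTime fun x => (l x).isEmpty :=
  casesList (g := fun _ => false) hl (const true) (by fun_prop) (fun x h => by simp [h])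
    (fun x a m h => by simp [h])

/-! ### Numbers -/

/-- A number as a list. -/
theorem replicate {f : α → ℕ} (hf : PolyTime f) : PolyTime fun x => List.replicate (f x) () :=
  comp (g := fun n : ℕ => List.replicate n ()) (of_code_eq code_replicate) hf

theorem length_unit {l : α → List Unit} (hl : PolyTime l) : PolyTime fun x => (l x).length :=
  comp (g := fun l : List Unit => l.length) (of_code_eq code_length_unit) hl

@[fun_prop]
theorem length {l : α → List β} (hl : PolyTime l) : PolyTime fun x => (l x).length := by
  have h : PolyTime fun x => ((l x).map fun _ => ()).length := length_unit (by fun_prop)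
  simpa using h

@[fun_prop]
theorem add {f g : α → ℕ} (hf : PolyTime f) (hg : PolyTime g) : PolyTime fun x => f x + g x := by
  have h : PolyTime fun x => (List.replicate (f x) () ++ List.replicate (g x) ()).length :=
    length_unit (hf.replicate.append hg.replicate)
  simpa using h

@[fun_prop]
theorem pred {f : α → ℕ} (hf : PolyTime f) : PolyTime fun x => (f x).pred := by
  have h : PolyTime fun x => (List.replicate (f x) ()).tail.length :=
    length_unit hf.replicate.tail
  simpa using h

@[fun_prop]
theorem sub {f g : α → ℕ} (hf : PolyTime f) (hg : PolyTime g) : PolyTime fun x => f x - g x := by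
  -- Truncated subtraction is the iterated predecessor, which never enlarges the data; the zero
  -- measure suffices.
  have h := iterate_of_measure hg.replicate hf (f := Nat.pred) (pred id) (fun y => 0) 0
    (by simp) (by simp) (by intro y; simp only [size_nat, Nat.pred_eq_sub_one]; omega)
  convert h using 2 with x
  rw [Nat.pred_iterate, List.length_replicate]

@[fun_prop]
theorem eqb_nat {f g : α → ℕ} (hf : PolyTime f) (hg : PolyTime g) :
    PolyTime fun x => eqb (f x) (g x) := by
  have h : PolyTime fun x =>
      (List.replicate ((f x - g x) + (g x - f x)) ()).isEmpty := isEmpty (replicate (by fun_prop))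
  convert h using 2 with x
  rw [Bool.eq_iff_iff, eqb_iff, List.isEmpty_iff, List.replicate_eq_nil_iff]; omega

@[fun_prop]
theorem ltb {f g : α → ℕ} (hf : PolyTime f) (hg : PolyTime g) :
    PolyTime fun x => Nat.blt (f x) (g x) := by
  have h : PolyTime fun x => eqb (f x + 1 - g x) 0 := by fun_prop
  convert h using 2 with x
  rw [Bool.eq_iff_iff, eqb_iff, Nat.blt_eq]; omega

@[fun_prop]
theorem min {f g : α → ℕ} (hf : PolyTime f) (hg : PolyTime g) :
    PolyTime fun x => Min.min (f x) (g x) := by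
  have h : PolyTime fun x => f x - (f x - g x) := by fun_prop
  convert h using 2 with x
  omega

/-- One step of counting down, recording the numbers. -/
theorem rangeStep_iterate (n k : ℕ) (h : k ≤ n) :
    (fun s : ℕ × List ℕ => (s.1.pred, s.1.pred :: s.2))^[k] (n, []) =
      (n - k, (List.range' (n - k) k)) := by
  induction k with
  | zero => simp
  | succ k ih =>
    rw [Function.iterate_succ_apply', ih (by omega)]
    have : n - k = n - (k + 1) + 1 := by omega
    simp [List.range'_succ, this]

@[fun_prop]
theorem range {f : α → ℕ} (hf : PolyTime f) : PolyTime fun x => List.range (f x) := by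
  have h := iterate_of_measure (g := fun x => (f x, ([] : List ℕ))) hf.replicate (by fun_prop)
    (f := fun s : ℕ × List ℕ => (s.1.pred, s.1.pred :: s.2)) (by fun_prop) (fun s => size s.1)
    (.X + 1) (by intro y; obtain ⟨a, b⟩ := y; simp only [size_pair]; omega)
    (by intro y; simp only [size_nat, Nat.pred_eq_sub_one]; omega)
    (by
      intro y; obtain ⟨a, b⟩ := y
      simp only [size_pair, size_cons, size_nat, Nat.pred_eq_sub_one, Polynomial.eval_add,
        Polynomial.eval_X, Polynomial.eval_one]
      omega)
  have h' := snd' h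
  simpa only [List.length_replicate, rangeStep_iterate _ _ le_rfl, Nat.sub_self,
    ← List.range_eq_range'] using h'

@[fun_prop]
theorem replicate' {f : α → ℕ} {g : α → β} (hf : PolyTime f) (hg : PolyTime g) :
    PolyTime fun x => List.replicate (f x) (g x) := by
  have h : PolyTime fun x => (List.range (f x)).map fun _ => g x :=
    map hf.range (hg.comp (f := fun y : α × ℕ => y.1) (by fun_prop))
  convert h using 2 with x
  simp

/-! ### Equality tests -/

/-- Types with an equality test in polynomial time. -/
class _root_.PolyTimeEq (α : Type) [TreeEnc α] [DecidableEq α] : Prop where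
  polyTime : PolyTime fun x : α × α => eqb x.1 x.2

@[fun_prop]
theorem eqb [DecidableEq β] [PolyTimeEq β] {f g : α → β} (hf : PolyTime f) (hg : PolyTime g) :
    PolyTime fun x => _root_.eqb (f x) (g x) :=
  PolyTimeEq.polyTime.comp (hf.pair hg)

instance : PolyTimeEq ℕ := ⟨by fun_prop⟩

theorem _root_.PolyTimeEq.of_injective [DecidableEq α] [DecidableEq β] [PolyTimeEq β] {f : α → β}
    (hf : PolyTime f) (h : Function.Injective f) : PolyTimeEq α where
  polyTime := by
    have h' : PolyTime fun x : α × α => _root_.eqb (f x.1) (f x.2) :=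
      eqb (hf.comp (by fun_prop)) (hf.comp (by fun_prop))
    convert h' using 2 with x
    rw [Bool.eq_iff_iff, eqb_iff, eqb_iff, h.eq_iff]

instance : PolyTimeEq Γ' :=
  .of_injective (f := symbolIndex) (of_code_eq fun _ => rfl) symbolIndex_injective

instance : PolyTimeEq SignType :=
  .of_injective (f := signIndex) (of_code_eq fun _ => rfl) signIndex_injective

instance [DecidableEq α] [DecidableEq β] [PolyTimeEq α] [PolyTimeEq β] : PolyTimeEq (α × β) where
  polyTime := by
    have h : PolyTime fun x : (α × β) × (α × β) =>
      _root_.eqb x.1.1 x.2.1 && _root_.eqb x.1.2 x.2.2 := by fun_prop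
    convert h using 2 with x
    rw [Bool.eq_iff_iff, Bool.and_eq_true, eqb_iff, eqb_iff, eqb_iff, Prod.ext_iff]

/-- The fold over `l` consumes `m` in parallel, and the lists agree if no test failed and nothing of
`m` is left. The default of `headD` is the current entry, so the comparison is vacuous on an
exhausted `m` and the separate emptiness test has to catch that case. -/
theorem foldl_eqb_iff {ε : Type} [DecidableEq ε] (l : List ε) : ∀ (b : Bool) (m : List ε),
    ((l.foldl (fun (s : Bool × List ε) a =>
      (s.1 && !s.2.isEmpty && _root_.eqb (s.2.headD a) a, s.2.tail)) (b, m)).1 = true ∧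
    (l.foldl (fun (s : Bool × List ε) a =>
      (s.1 && !s.2.isEmpty && _root_.eqb (s.2.headD a) a, s.2.tail)) (b, m)).2 = []) ↔
      (b = true ∧ l = m) := by
  induction l with
  | nil => exact fun b m => and_congr_right fun _ => eq_comm
  | cons a l ih =>
    intro b m
    rw [List.foldl_cons, ih]
    cases m with
    | nil => simp
    | cons c m => simp [and_assoc, @eq_comm _ c a]

instance [DecidableEq α] [PolyTimeEq α] : PolyTimeEq (List α) where
  polyTime := by
    have h := foldl (α := List α × List α) (l := fun x => x.1) (g := fun x => (true, x.2))
      (f := fun _ (s : Bool × List α) a =>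
        (s.1 && !s.2.isEmpty && _root_.eqb (s.2.headD a) a, s.2.tail)) (by fun_prop) (by fun_prop)
      (by fun_prop) (.C 3) (fun x s a => by
        obtain ⟨b, m⟩ := s
        have h1 := size_bool_le (b && !m.isEmpty && _root_.eqb (m.headD a) a)
        have h2 := size_le_of_sublist (List.tail_sublist m)
        rw [Polynomial.eval_C, size_pair, size_pair]; dsimp only; omega)
    have h' := (fst' h).and (snd' h).isEmpty
    convert h' using 2 with x
    rw [Bool.eq_iff_iff, Bool.and_eq_true, List.isEmpty_iff, foldl_eqb_iff, eqb_iff]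
    simp

end PolyTime

/-! ### Input, output and bundled machines -/

namespace StackProg

/-- Move one symbol of the input to the front of the list on the main register. -/
def readSymbol : List Γ' → StackProg StackSym
  | [] => pushWord []
  | x :: l => .ite .inp (fun o => o = some x)
      (.seq (.pop .inp) (.seq (pushWord (code x)) (.push (.reg 0) true))) (readSymbol l)

theorem run_readSymbol (x : Γ') (w : List Γ') (m : List Bool) : ∀ l : List Γ', x ∈ l →
    (readSymbol l).RunIn (st (x :: w) [] m [] [] [])
      (st w [] (true :: (code x ++ m)) [] [] []) (l.length + 15) := by
  intro l
  induction l with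
  | nil => intro h; simp at h
  | cons y l ih =>
    intro h
    by_cases hxy : y = x
    · subst hxy
      -- Symbol indices are at most 5, and the unary code of `n` has length `2 * n + 1`.
      have h1 : (code y).length ≤ 11 := by rcases y with _ | (_ | _) | _ | _ | _ <;> decide
      refine (RunIn.ite_true (by simp) ((run_pop (update_inp ..)).runIn.seq
        ((run_pushWord w (code y) m).seq (run_push (update_reg0 ..)).runIn))).mono ?_
      simp only [List.length_cons]; omega
    · have hx : x ∈ l := by
        rcases List.mem_cons.1 h with h | h
        · exact absurd h.symm hxy
        · exact h
      exact (RunIn.ite_false (by simpa using fun h => hxy h.symm) (ih hx)).mono (by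
        simp only [List.length_cons]; omega)

/-- Move the input, reversed, to the main register. -/
def readInput : StackProg StackSym :=
  .seq (.push (.reg 0) false) (.loop .inp (fun o => o.isSome)
    (readSymbol [.blank, .bit true, .bit false, .bra, .ket, .comma]))

/-- Symbols are put in front of the list as they are read, hence the reversal. A symbol costs at
most `6 + 15` steps and one test of the loop. -/
theorem run_readInput (w : List Γ') :
    readInput.RunIn (st w [] [] [] [] []) (mainOnly (code w.reverse)) (22 * w.length + 2) := by
  have key : ∀ (w l : List Γ'), RunIn (.loop .inp (fun o => o.isSome)
      (readSymbol [.blank, .bit true, .bit false, .bra, .ket, .comma]))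
      (st w [] (code l) [] [] []) (mainOnly (code (w.reverse ++ l))) (22 * w.length + 1) := by
    intro w
    induction w with
    | nil => exact fun l => .loop_false rfl
    | cons x w ih =>
      intro l
      refine (RunIn.loop_true rfl (run_readSymbol x w (code l) _ ?_) (ih (x :: l))).congr ?_ ?_
      · rcases x with _ | (_ | _) | _ | _ | _ <;> simp
      · simp
      · simp only [List.length_cons, List.length_nil]; omega
  have h := key w []
  rw [List.append_nil] at h
  exact ((run_push (update_reg0 ..)).runIn.seq h).mono (by omega)

/-- Move a truth value from the main register to the output. -/
def writeOutput : StackProg StackSym :=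
  .ite (.reg 0) (fun o => o = some true)
    (.seq (.pop (.reg 0)) (.seq (.pop (.reg 0)) (.seq (.pop (.reg 0)) (.push .out true))))
    (.seq (.pop (.reg 0)) (.push .out false))

theorem run_writeOutput (b : Bool) :
    writeOutput.RunIn (mainOnly (code b)) (st [] [b] [] [] [] []) 5 := by
  cases b
  · exact (RunIn.ite_false rfl ((run_popMain _ _).seq (run_push (update_out ..)).runIn)).mono
      (by omega)
  · exact RunIn.ite_true rfl ((run_popMain _ _).seq ((run_popMain _ _).seq ((run_popMain _ _).seq
      (run_push (update_out ..)).runIn)))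

theorem initList_toFinTM2 (P : StackProg StackSym) (w : List Γ') :
    Turing.initList (P.toFinTM2 .inp .out) w =
      ⟨some (some P.entry), false, st w [] [] [] [] []⟩ := by
  have h : (fun k : StackName =>
      @dite (List (StackSym k)) (k = .inp) (instDecidableEqStackName k .inp)
        (fun h => by rw [h]; exact w) fun _ => []) = st w [] [] [] [] [] := by
    funext k
    rcases k with _ | _ | j
    · rfl
    · rfl
    · fin_cases j <;> rfl
  exact congrArg (Turing.TM2.Cfg.mk _ _) h

theorem haltList_toFinTM2 (P : StackProg StackSym) (w : List Bool) :
    Turing.haltList (P.toFinTM2 .inp .out) w = ⟨none, false, st [] w [] [] [] []⟩ := by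
  have h : (fun k : StackName =>
      @dite (List (StackSym k)) (k = .out) (instDecidableEqStackName k .out)
        (fun h => by rw [h]; exact w) fun _ => []) = st [] w [] [] [] [] := by
    funext k
    rcases k with _ | _ | j
    · rfl
    · rfl
    · fin_cases j <;> rfl
  exact congrArg (Turing.TM2.Cfg.mk _ _) h

end StackProg

theorem TreeEnc.size_word_le (w : List Γ') : size w ≤ 12 * w.length + 1 := by
  induction w with
  | nil => rfl
  | cons x w ih =>
    have h1 : size x ≤ 11 := by rcases x with _ | (_ | _) | _ | _ | _ <;> decide
    rw [size_cons, List.length_cons]; omega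

open Classical in
theorem StackProg.inP (P : StackProg StackSym) (q : Polynomial ℕ) {L : Language Γ'}
    (h : ∀ w, P.RunIn (st w [] [] [] [] []) (st [] [decide (w ∈ L)] [] [] [] [])
      (q.eval w.length)) : InP L := by
  choose t ht h using h
  -- The additional step executes the final `halt`.
  refine ⟨⟨⟨P.toFinTM2 .inp .out, Equiv.refl _, Equiv.refl _⟩, q + 1,
    fun w => ⟨⟨t w + 1, ?_⟩, by simpa using ht w⟩⟩⟩
  have h1 : List.map (Equiv.refl Γ').invFun w = w := List.map_id w
  have h2 := (congrArg (Turing.initList (P.toFinTM2 .inp .out)) h1).trans (initList_toFinTM2 P w)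
  exact (congrArg (fun c => (flip bind (Turing.TM2.step P.machine))^[t w + 1] (some c)) h2).trans
    (Eq.trans (h w).machine (congrArg some (haltList_toFinTM2 P [decide (w ∈ L)])).symm)

/-- A language that a program decides in polynomial time is in `P`. -/
theorem PolyTime.inP {f : List Γ' → Bool} (hf : PolyTime f) {L : Language Γ'}
    (hL : ∀ w, w ∈ L ↔ f w = true) : InP L := by
  classical
  -- Reading reverses the input, so the program for `f` is preceded by one that reverses it again.
  obtain ⟨P, p, hP⟩ := hf.comp (f := fun w : List Γ' => w.reverse) (reverse id)
  refine StackProg.inP (.seq readInput (.seq P writeOutput))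
    (22 * .X + 7 + p.comp (12 * .X + 1)) fun w => ?_
  have h2 := (hP w.reverse).2 []
  dsimp only at h2
  rw [List.append_nil, List.append_nil, List.reverse_reverse] at h2
  have h4 : f w = decide (w ∈ L) := by rw [Bool.eq_iff_iff, decide_eq_true_iff, hL]
  rw [h4] at h2
  have h3 := p.eval_le_eval_nat (size_word_le w.reverse)
  rw [List.length_reverse] at h3
  refine ((run_readInput w).seq (h2.seq (run_writeOutput _))).congr ?_ ?_
  · congr
  · simp only [Polynomial.eval_add, Polynomial.eval_mul, Polynomial.eval_X, Polynomial.eval_ofNat,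
      Polynomial.eval_comp, Polynomial.eval_one]
    omega

/-! ### The simulation game -/

/-- Spoiler wins the weak simulation game. -/
inductive LTS.SpoilerWins {V₁ V₂ Act : Type*} (T₁ : LTS V₁ Act) (T₂ : LTS V₂ Act) (τ : Act) :
    V₁ → V₂ → Prop
  | step {x a x' t} : T₁.step x a x' → (∀ t', T₂.WeakStep τ t a t' → SpoilerWins T₁ T₂ τ x' t') →
      SpoilerWins T₁ T₂ τ x t

/-- A weak simulation hands Duplicator an answer to every move, which refutes a win of Spoiler by
induction on the win. Conversely the complement of Spoiler's winning region is itself a weak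
simulation. -/
theorem LTS.weaklySimulatedBy_iff {V₁ V₂ Act : Type*} {T₁ : LTS V₁ Act} {T₂ : LTS V₂ Act} {τ : Act}
    {x : V₁} {t : V₂} : WeaklySimulatedBy T₁ T₂ τ x t ↔ ¬ SpoilerWins T₁ T₂ τ x t := by
  constructor
  · rintro ⟨R, hR, h⟩ hw
    induction hw with
    | step hs _ ih =>
      obtain ⟨t', ht, h'⟩ := hR _ _ h _ _ hs
      exact ih t' ht h'
  · intro h
    refine ⟨fun x t => ¬ SpoilerWins T₁ T₂ τ x t, fun x t hxt a x' hs => ?_, h⟩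
    by_contra! hc
    exact hxt (.step hs hc)

/-- The effect of a transition on the counter. -/
def SignType.applyCounter : SignType → ℕ → ℕ
  | .neg, m => m - 1
  | .zero, m => m
  | .pos, m => m + 1

namespace OneCounterNet

variable {Q S Act : Type*} {N : OneCounterNet Q Act} {T : LTS S Act} {τ : Act}

/-- The guard on decrements makes the truncated predecessor agree with integer subtraction, so the
game can be treated in `ℕ`. -/
theorem toLTS_step_iff {p p' : Q} {m m' : ℕ} {a : Act} : N.toLTS.step (p, m) a (p', m') ↔
    ∃ d : SignType, (p, a, d, p') ∈ N.δ ∧ (d = .neg → 0 < m) ∧ m' = d.applyCounter m := by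
  refine exists_congr fun d => and_congr_right fun _ => ?_
  cases d
  · simp [SignType.applyCounter]
  · simp [SignType.applyCounter]; omega
  · simp [SignType.applyCounter]; omega

/-- Spoiler wins the game in which the counter is capped at `B`. -/
inductive CappedWins (N : OneCounterNet Q Act) (T : LTS S Act) (τ : Act) (B : ℕ) : Q → ℕ → S → Prop
  | step {p a d p' m t} : (p, a, d, p') ∈ N.δ → (d = .neg → 0 < m) →
      (∀ t', T.WeakStep τ t a t' → CappedWins N T τ B p' (min (d.applyCounter m) B) t') →
      CappedWins N T τ B p m t

/-! ### Monotonicity in the counter and the gap argument -/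

theorem _root_.SignType.applyCounter_mono (d : SignType) {m m' : ℕ} (h : m ≤ m') :
    d.applyCounter m ≤ d.applyCounter m' := by
  cases d <;> simp only [SignType.applyCounter] <;> omega

theorem _root_.SignType.le_applyCounter (d : SignType) (m : ℕ) : m - 1 ≤ d.applyCounter m := by
  cases d <;> simp only [SignType.applyCounter] <;> omega

theorem _root_.SignType.applyCounter_pred (d : SignType) {m : ℕ} (h : 2 ≤ m) :
    d.applyCounter (m - 1) = d.applyCounter m - 1 := by
  cases d <;> simp only [SignType.applyCounter] <;> omega

/-- Without zero tests a larger counter disables no move, so Spoiler repeats his strategy. -/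
theorem CappedWins.mono {B m m' : ℕ} {p : Q} {t : S} (h : N.CappedWins T τ B p m t)
    (hm : m ≤ m') : N.CappedWins T τ B p m' t := by
  induction h generalizing m' with
  | @step p a d p' m t hδ hd _ ih =>
    exact .step hδ (fun h => (hd h).trans_le hm) fun t' ht =>
      ih t' ht (min_le_min_right _ (d.applyCounter_mono hm))

theorem spoilerWins_mono {m m' : ℕ} {p : Q} {t : S} (h : LTS.SpoilerWins N.toLTS T τ (p, m) t)
    (hm : m ≤ m') : LTS.SpoilerWins N.toLTS T τ (p, m') t := by
  generalize hx : (p, m) = x at h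
  induction h generalizing p m m' with
  | @step x a x' t hs _ ih =>
    subst hx
    obtain ⟨p', k⟩ := x'
    obtain ⟨d, hδ, hd, rfl⟩ := toLTS_step_iff.1 hs
    exact .step (toLTS_step_iff.2 ⟨d, hδ, fun h => (hd h).trans_le hm, rfl⟩) fun t' ht =>
      ih t' ht (d.applyCounter_mono hm) rfl

/-- A positive counter value that is nobody's minimal winning value suffices for all. -/
theorem CappedWins.of_gap {B v : ℕ} (hv : 0 < v) (hB : v ≤ B + 1)
    (hgap : ∀ p t, N.CappedWins T τ B p v t → N.CappedWins T τ B p (v - 1) t) {p : Q} {t : S} {m : ℕ}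
    (h : N.CappedWins T τ B p m t) : N.CappedWins T τ B p v t := by
  -- A pair that is won at `m` but not at `v` is won with one unit less. Repeating this would bring
  -- the winning value down to `0`, hence below `v`, a contradiction.
  have key : ∀ {p t m}, N.CappedWins T τ B p m t → ¬ N.CappedWins T τ B p v t →
      N.CappedWins T τ B p (m - 1) t := by
    intro p t m h hn
    induction h with
    | @step p a d p' m t hδ hd hw ih =>
      have hm : v < m := by
        by_contra! hm
        exact hn ((CappedWins.step hδ hd hw).mono hm)
      refine .step hδ (fun _ => by omega) fun t' ht => ?_
      rw [d.applyCounter_pred (by omega)]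
      -- If the successor pair is won at `v`, it is won at `v - 1` by the gap, and the reduced
      -- counter still is that large because `v < m` and `v - 1 ≤ B`. Otherwise the induction
      -- hypothesis saves the unit further on.
      by_cases hc : N.CappedWins T τ B p' v t'
      · refine (hgap _ _ hc).mono ?_
        have := d.le_applyCounter m
        omega
      · exact (ih t' ht hc).mono (by omega)
  by_contra hn
  have : ∀ i, N.CappedWins T τ B p (m - i) t := by
    intro i
    induction i with
    | zero => exact h
    | succ i ih => exact key ih hn
  exact hn ((this m).mono (by omega))

/-- If each of the `|Q| * |S| + 1` values from `1` on were the minimal winning value of some pair,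
these pairs would be distinct by monotonicity, which is one too many. So there is a gap `v`; winning
at `v` means winning at `v - 1`, which is at most `|Q| * |S|`. -/
theorem CappedWins.le_card [Fintype Q] [Fintype S] {B : ℕ}
    (hB : Fintype.card Q * Fintype.card S ≤ B) {p : Q} {t : S} {m : ℕ}
    (h : N.CappedWins T τ B p m t) :
    N.CappedWins T τ B p (Fintype.card Q * Fintype.card S) t := by
  obtain ⟨v, hv1, hv2, hv⟩ : ∃ v, 0 < v ∧ v ≤ Fintype.card Q * Fintype.card S + 1 ∧
      ∀ p t, N.CappedWins T τ B p v t → N.CappedWins T τ B p (v - 1) t := by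
    by_contra! hc
    have hc' : ∀ i : Fin (Fintype.card Q * Fintype.card S + 1), ∃ x : Q × S,
        N.CappedWins T τ B x.1 (i + 1) x.2 ∧ ¬ N.CappedWins T τ B x.1 i x.2 := by
      intro i
      obtain ⟨p, t, h1, h2⟩ := hc (i + 1) (by omega) (by omega)
      exact ⟨(p, t), h1, h2⟩
    choose f hf1 hf2 using hc'
    have hf : Function.Injective f := by
      intro i j hij
      by_contra hne
      rcases lt_or_gt_of_ne (Fin.val_ne_of_ne hne) with h | h
      · exact hf2 j (hij ▸ (hf1 i).mono h)
      · exact hf2 i (hij ▸ (hf1 j).mono h)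
    have := Fintype.card_le_of_injective f hf
    rw [Fintype.card_fin, Fintype.card_prod] at this
    omega
  exact (hv _ _ (h.of_gap hv1 (by omega) hv)).mono (by omega)

/-- Capping the counter does not change the winner. -/
theorem spoilerWins_iff_cappedWins [Fintype Q] [Fintype S] {B : ℕ}
    (hB : Fintype.card Q * Fintype.card S < B) {p : Q} {t : S} {m : ℕ} :
    LTS.SpoilerWins N.toLTS T τ (p, m) t ↔ N.CappedWins T τ B p (min m B) t := by
  constructor
  · intro h
    generalize hx : (p, m) = x at h
    induction h generalizing p m with
    | @step x a x' t hs _ ih =>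
      subst hx
      obtain ⟨p', k⟩ := x'
      obtain ⟨d, hδ, hd, rfl⟩ := toLTS_step_iff.1 hs
      refine .step hδ (fun h => by have := hd h; omega) fun t' ht => ?_
      have h1 := ih t' ht rfl
      -- Below the cap both games agree. Above it, the capped game continues with at least `B - 1`
      -- after the move; as `B` exceeds `|Q| * |S|` strictly, this still suffices by `le_card`.
      by_cases hm : m ≤ B
      · rwa [min_eq_left hm]
      · refine (h1.le_card hB.le).mono ?_
        have := d.le_applyCounter (min m B)
        omega
  · intro h
    -- Capping only takes counter units away from Spoiler, so a capped win is a win.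
    suffices ∀ {p k t}, N.CappedWins T τ B p k t → LTS.SpoilerWins N.toLTS T τ (p, k) t from
      spoilerWins_mono (this h) (min_le_left _ _)
    intro p k t h
    induction h with
    | @step p a d p' k t hδ hd _ ih =>
      exact .step (toLTS_step_iff.2 ⟨d, hδ, hd, rfl⟩) fun t' ht =>
        spoilerWins_mono (ih t' ht) (min_le_left _ _)

end OneCounterNet

/-! ### Least fixed points on lists -/

/-- The least fixed point of a monotone rule, restricted to a list. -/
def lfpList {α : Type} (dom : List α) (P : List α → α → Bool) : List α :=
  (fun X => dom.filter (P X))^[dom.length] []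

section lfpList

variable {α : Type} {dom : List α} {P : List α → α → Bool}

theorem lfpList_induction {motive : α → Prop}
    (h : ∀ X a, a ∈ dom → (∀ x ∈ X, motive x) → P X a = true → motive a) :
    ∀ a ∈ lfpList dom P, motive a := by
  unfold lfpList
  generalize dom.length = n
  induction n with
  | zero => simp
  | succ n ih =>
    intro a ha
    rw [Function.iterate_succ_apply', List.mem_filter] at ha
    exact h _ a ha.1 ih ha.2

/-- The iterates form an increasing chain of sublists of `dom`. Until the chain is stationary each
round adds an entry, so `dom.length` rounds suffice. -/
theorem filter_lfpList (hP : ∀ X Y a, X ⊆ Y → P X a = true → P Y a = true) :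
    dom.filter (P (lfpList dom P)) = lfpList dom P := by
  set F : List α → List α := fun X => dom.filter (P X) with hF
  have hsub : ∀ i, (F^[i] []).Sublist (F^[i + 1] []) := by
    intro i
    induction i with
    | zero => exact List.nil_sublist _
    | succ i ih =>
      rw [Function.iterate_succ_apply', Function.iterate_succ_apply' F (i + 1)]
      exact List.monotone_filter_right _ fun a => hP _ _ a ih.subset
  have hlen : ∀ i, i ≤ (F^[i] []).length ∨ F (F^[i] []) = F^[i] [] := by
    intro i
    induction i with
    | zero => simp
    | succ i ih =>
      rw [Function.iterate_succ_apply']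
      rcases ih with ih | ih
      · by_cases h : F (F^[i] []) = F^[i] []
        · exact .inr (by rw [h, h])
        · have h1 := hsub i
          rw [Function.iterate_succ_apply'] at h1
          have h2 := h1.length_le
          have h3 : (F^[i] []).length ≠ (F (F^[i] [])).length := fun he => h (h1.eq_of_length he).symm
          exact .inl (by omega)
      · exact .inr (by rw [ih, ih])
  rcases hlen (dom.length) with h | h
  · have h1 := hsub dom.length
    have h2 : (F^[dom.length + 1] []).length ≤ dom.length := by
      rw [Function.iterate_succ_apply']
      exact List.length_filter_le _ _
    have h3 := h1.eq_of_length (le_antisymm h1.length_le (h2.trans h))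
    rw [Function.iterate_succ_apply'] at h3
    exact h3.symm
  · exact h

theorem mem_lfpList_iff (hP : ∀ X Y a, X ⊆ Y → P X a = true → P Y a = true) {a : α} :
    a ∈ lfpList dom P ↔ a ∈ dom ∧ P (lfpList dom P) a = true := by
  conv_lhs => rw [← filter_lfpList hP]
  rw [List.mem_filter]

end lfpList

/-! ### Polynomial time for least fixed points and counter updates -/

namespace PolyTime

variable {α β : Type} [TreeEnc α] [TreeEnc β]

-- Every iterate is a sublist of the domain, so its size is bounded by that of the domain, which is
-- computed from the unchanging context.
@[fun_prop]
theorem lfpList {dom : α → List β} {P : α → List β → β → Bool} (hd : PolyTime dom)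
    (hP : PolyTime fun y : α × List β × β => P y.1 y.2.1 y.2.2) :
    PolyTime fun x => _root_.lfpList (dom x) (P x) := by
  have ⟨_, q, hq⟩ := hd
  have hs : PolyTime fun s : α × List β => (s.1, (dom s.1).filter (P s.1 s.2)) :=
    .pair (by fun_prop) (.filter (hd.comp (by fun_prop))
      (hP.comp (f := fun y : (α × List β) × β => (y.1.1, y.1.2, y.2)) (by fun_prop)))
  have h := iterate_of_measure (g := fun x => (x, ([] : List β))) hd (by fun_prop) hs
    (fun s => size s.1) q (fun y => by obtain ⟨a, b⟩ := y; rw [size_pair]; dsimp only; omega)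
    (fun y => le_rfl) (fun y => by
      obtain ⟨a, b⟩ := y
      have h1 := size_le_of_sublist (List.filter_sublist (p := P a b) (l := dom a))
      have h2 := (hq a).1
      rw [size_pair, size_pair]; dsimp only; omega)
  have key : ∀ x n, (fun s : α × List β => (s.1, (dom s.1).filter (P s.1 s.2)))^[n] (x, []) =
      (x, (fun X => (dom x).filter (P x X))^[n] []) := by
    intro x n
    induction n with
    | zero => rfl
    | succ n ih => rw [Function.iterate_succ_apply', ih, Function.iterate_succ_apply']
  have h' := snd' h
  simp only [key] at h'
  exact h'

@[fun_prop]
theorem mul {f g : α → ℕ} (hf : PolyTime f) (hg : PolyTime g) : PolyTime fun x => f x * g x := by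
  have h : PolyTime fun x =>
      ((List.range (f x)).flatMap fun _ => List.replicate (g x) ()).length :=
    length (flatMap hf.range (replicate (hg.comp (f := fun y : α × ℕ => y.1) (by fun_prop))))
  convert h using 2 with x
  simp

@[fun_prop]
theorem applyCounter {d : α → SignType} {f : α → ℕ} (hd : PolyTime d) (hf : PolyTime f) :
    PolyTime fun x => (d x).applyCounter (f x) := by
  have h : PolyTime fun x => bif _root_.eqb (d x) .neg then f x - 1 else
    bif _root_.eqb (d x) .zero then f x else f x + 1 := by fun_prop
  convert h using 2 with x
  cases d x <;> rfl

end PolyTime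

/-! ### The game as a computation -/

/-- Transitions of a net with numbered states and actions. -/
abbrev NetTransitions : Type := List (ℕ × ℕ × SignType × ℕ)

/-- Transitions of a finite system with numbered states and actions. -/
abbrev FinTransitions : Type := List (ℕ × ℕ × ℕ)

/-- The pairs of states `(s, t)` such that `t` is reachable from `s` by internal steps. -/
def tauReach (n : ℕ) (F : FinTransitions) : List (ℕ × ℕ) :=
  lfpList ((List.range n).flatMap fun s => (List.range n).map fun t => (s, t)) fun X x =>
    eqb x.1 x.2 || F.any fun e => eqb e.2.1 0 && eqb e.2.2 x.2 && X.any fun y => eqb y (x.1, e.1)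

/-- The weak step relation, given the reachability by internal steps. -/
def weakStepTest (R : List (ℕ × ℕ)) (F : FinTransitions) (s a t : ℕ) : Bool :=
  bif eqb a 0 then R.any fun y => eqb y (s, t) else
    F.any fun e => eqb e.2.1 a && (R.any fun y => eqb y (s, e.1)) &&
      R.any fun y => eqb y (e.2.2, t)

/-- The positions `(p, m, s)` from which Spoiler wins the game with counter values up to `B`. -/
def winList (k n B : ℕ) (N : NetTransitions) (F : FinTransitions) (R : List (ℕ × ℕ)) :
    List (ℕ × ℕ × ℕ) :=
  lfpList ((List.range k).flatMap fun p => (List.range (B + 1)).flatMap fun m =>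
    (List.range n).map fun s => (p, m, s)) fun X x =>
      N.any fun e => eqb e.1 x.1 && (!(eqb e.2.2.1 .neg) || Nat.blt 0 x.2.1) &&
        (List.range n).all fun t => !(weakStepTest R F x.2.2 e.2.1 t) ||
          X.any fun y => eqb y (e.2.2.2, min (e.2.2.1.applyCounter x.2.1) B, t)

theorem PolyTime.tauReach {α : Type} [TreeEnc α] {n : α → ℕ} {F : α → FinTransitions}
    (hn : PolyTime n) (hF : PolyTime F) : PolyTime fun x => _root_.tauReach (n x) (F x) := by
  have h : PolyTime fun x : ℕ × FinTransitions => _root_.tauReach x.1 x.2 := by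
    unfold _root_.tauReach
    fun_prop
  exact h.comp (hn.pair hF)

theorem PolyTime.winList {α : Type} [TreeEnc α] {k n B : α → ℕ} {N : α → NetTransitions}
    {F : α → FinTransitions} {R : α → List (ℕ × ℕ)} (hk : PolyTime k) (hn : PolyTime n)
    (hB : PolyTime B) (hN : PolyTime N) (hF : PolyTime F) (hR : PolyTime R) :
    PolyTime fun x => _root_.winList (k x) (n x) (B x) (N x) (F x) (R x) := by
  have h : PolyTime fun x : ℕ × ℕ × ℕ × NetTransitions × FinTransitions × List (ℕ × ℕ) =>
      _root_.winList x.1 x.2.1 x.2.2.1 x.2.2.2.1 x.2.2.2.2.1 x.2.2.2.2.2 := by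
    unfold _root_.winList weakStepTest
    fun_prop
  exact h.comp (hk.pair (hn.pair (hB.pair (hN.pair (hF.pair hR)))))

namespace WeakSimInstance

/-- The transitions of the net, by numbers. -/
def netData (I : WeakSimInstance) : NetTransitions :=
  I.netTrans.map fun t => (t.1.val, t.2.1.val, t.2.2.1, t.2.2.2.val)

/-- The transitions of the finite system, by numbers. -/
def finData (I : WeakSimInstance) : FinTransitions :=
  I.finTrans.map fun t => (t.1.val, t.2.1.val, t.2.2.val)

theorem any_eqb_iff {α : Type} [DecidableEq α] {l : List α} {a : α} :
    (l.any fun y => eqb y a) = true ↔ a ∈ l := by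
  simp [List.any_eq_true]

theorem mem_tauReach_iff (I : WeakSimInstance) (s t : Fin I.numFin) :
    (s.val, t.val) ∈ tauReach I.numFin I.finData ↔
      Relation.ReflTransGen (fun x y => I.finiteSystem.step x 0 y) s t := by
  constructor
  · intro h
    suffices ∀ x ∈ tauReach I.numFin I.finData, ∀ s t : Fin I.numFin, x = (s.val, t.val) →
        Relation.ReflTransGen (fun x y => I.finiteSystem.step x 0 y) s t from this _ h s t rfl
    refine lfpList_induction ?_
    rintro X x - ih hx s t rfl
    simp only [Bool.or_eq_true, eqb_iff, Fin.val_inj, List.any_eq_true, Bool.and_eq_true,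
      finData, List.mem_map] at hx
    rcases hx with rfl | ⟨_, ⟨⟨u, a, v⟩, he, rfl⟩, ⟨h1, h2⟩, y, hy, rfl⟩
    · exact .refl
    · have ha : a = 0 := Fin.ext (by simpa using h1)
      have hv : v = t := Fin.ext h2
      subst ha hv
      exact (ih _ hy s u rfl).tail he
  · intro h
    -- Monotonicity makes the iterate after `dom.length` rounds a fixed point, so the rule may be
    -- applied once more.
    have mono : ∀ (X Y : List (ℕ × ℕ)) (a : ℕ × ℕ), X ⊆ Y →
        (eqb a.1 a.2 || I.finData.any fun e => eqb e.2.1 0 && eqb e.2.2 a.2 &&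
          X.any fun y => eqb y (a.1, e.1)) = true →
        (eqb a.1 a.2 || I.finData.any fun e => eqb e.2.1 0 && eqb e.2.2 a.2 &&
          Y.any fun y => eqb y (a.1, e.1)) = true := by
      intro X Y a hXY
      simp only [Bool.or_eq_true, List.any_eq_true (l := I.finData), Bool.and_eq_true,
        any_eqb_iff]
      rintro (h | ⟨e, he, h1, h2⟩)
      · exact .inl h
      · exact .inr ⟨e, he, h1, hXY h2⟩
    unfold tauReach
    induction h with
    | refl => exact (mem_lfpList_iff mono).2 ⟨by simp, by simp⟩
    | @tail u v _ huv ih =>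
      refine (mem_lfpList_iff mono).2 ⟨by simp, ?_⟩
      rw [Bool.or_eq_true]
      refine .inr (List.any_eq_true.2 ⟨(u.val, 0, v.val), ?_, ?_⟩)
      · exact List.mem_map.2 ⟨_, huv, rfl⟩
      · simp only [Bool.and_eq_true, eqb_iff, any_eqb_iff, true_and]
        exact ih

theorem weakStepTest_iff (I : WeakSimInstance) (s t : Fin I.numFin) (a : Fin (I.numVisible + 1)) :
    weakStepTest (tauReach I.numFin I.finData) I.finData s a t = true ↔
      I.finiteSystem.WeakStep 0 s a t := by
  unfold weakStepTest LTS.WeakStep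
  by_cases ha : a = 0
  · subst ha
    simp only [Fin.val_zero, eqb, decide_true, cond_true]
    rw [← mem_tauReach_iff, ← any_eqb_iff]
    simp [eqb]
  · have : eqb a.val 0 = false := by
      rw [Bool.eq_false_iff, Ne, eqb_iff]
      exact fun h => ha (Fin.ext h)
    simp only [this, cond_false, ha, false_and, false_or, ne_eq, not_false_eq_true, true_and,
      List.any_eq_true (l := I.finData), Bool.and_eq_true, any_eqb_iff, eqb_iff]
    constructor
    · rintro ⟨_, he, ⟨h1, h2⟩, h3⟩
      obtain ⟨⟨u, b, v⟩, he', rfl⟩ := List.mem_map.1 he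
      have hb : b = a := Fin.ext h1
      subst hb
      exact ⟨u, v, (mem_tauReach_iff I s u).1 h2, he', (mem_tauReach_iff I v t).1 h3⟩
    · rintro ⟨u, v, h1, h2, h3⟩
      exact ⟨_, List.mem_map.2 ⟨_, h2, rfl⟩, ⟨rfl, (mem_tauReach_iff I s u).2 h1⟩,
        (mem_tauReach_iff I v t).2 h3⟩

/-- Both sides are least fixed points of one rule, and `rule` identifies the Boolean test with the
premises of `CappedWins.step`. The list only contains counter values up to `B`, hence the
restriction on `m`. -/
theorem mem_winList_iff (I : WeakSimInstance) (B : ℕ) (p : Fin I.numNet) (m : ℕ) (hm : m ≤ B)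
    (s : Fin I.numFin) :
    (p.val, m, s.val) ∈ winList I.numNet I.numFin B I.netData I.finData
      (tauReach I.numFin I.finData) ↔ I.net.CappedWins I.finiteSystem 0 B p m s := by
  have rule : ∀ (X : List (ℕ × ℕ × ℕ)) (p : Fin I.numNet) (m : ℕ) (s : Fin I.numFin),
      (I.netData.any fun e => eqb e.1 p.val && (!(eqb e.2.2.1 .neg) || Nat.blt 0 m) &&
        (List.range I.numFin).all fun t =>
          !(weakStepTest (tauReach I.numFin I.finData) I.finData s.val e.2.1 t) ||
          X.any fun y => eqb y (e.2.2.2, min (e.2.2.1.applyCounter m) B, t)) = true ↔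
      ∃ a d p', (p, a, d, p') ∈ I.net.δ ∧ (d = SignType.neg → 0 < m) ∧
        ∀ t : Fin I.numFin, I.finiteSystem.WeakStep 0 s a t →
          (p'.val, min (d.applyCounter m) B, t.val) ∈ X := by
    intro X p m s
    have hneg : ∀ d : SignType, (!(eqb d .neg) || Nat.blt 0 m) = true ↔
        (d = SignType.neg → 0 < m) := by
      intro d
      rw [imp_iff_not_or]; simp [eqb]
    simp only [List.any_eq_true (l := I.netData), Bool.and_eq_true, List.all_eq_true,
      List.mem_range, eqb_iff, hneg]
    constructor
    · rintro ⟨_, he, ⟨h1, h2⟩, h3⟩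
      obtain ⟨⟨q, a, d, p'⟩, he', rfl⟩ := List.mem_map.1 he
      have hq : q = p := Fin.ext h1
      subst hq
      refine ⟨a, d, p', he', h2, fun t ht => ?_⟩
      have h4 := h3 t.val t.isLt
      rw [(weakStepTest_iff I s t a).2 ht] at h4
      exact any_eqb_iff.1 h4
    · rintro ⟨a, d, p', he, h2, h3⟩
      refine ⟨_, List.mem_map.2 ⟨_, he, rfl⟩, ⟨rfl, h2⟩, fun t ht => ?_⟩
      rw [Bool.or_eq_true, any_eqb_iff, Bool.not_eq_true', ← Bool.not_eq_true]
      by_cases hw : I.finiteSystem.WeakStep 0 s a ⟨t, ht⟩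
      · exact .inr (h3 _ hw)
      · exact .inl fun h => hw ((weakStepTest_iff I s ⟨t, ht⟩ a).1 h)
  constructor
  · intro h
    suffices ∀ x ∈ winList I.numNet I.numFin B I.netData I.finData
        (tauReach I.numFin I.finData), ∀ (p : Fin I.numNet) m (s : Fin I.numFin),
        x = (p.val, m, s.val) → I.net.CappedWins I.finiteSystem 0 B p m s from this _ h p m s rfl
    refine lfpList_induction ?_
    rintro X x - ih hx p m s rfl
    obtain ⟨a, d, p', he, hd, ht⟩ := (rule X p m s).1 hx
    exact .step he hd fun t' h' => ih _ (ht t' h') _ _ _ rfl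
  · intro h
    induction h with
    | @step p a d p' m s he hd _ ih =>
      unfold winList at *
      rw [mem_lfpList_iff]
      -- The cap keeps the next counter value within the domain, so the induction hypothesis
      -- applies.
      · refine ⟨by simp; omega, (rule _ p m s).2 ⟨a, d, p', he, hd,
          fun t ht => ih t ht (min_le_right _ _)⟩⟩
      · intro X Y x hXY
        simp only [List.any_eq_true (l := I.netData), Bool.and_eq_true, List.all_eq_true,
          List.mem_range, Bool.or_eq_true, any_eqb_iff]
        rintro ⟨e, he, h1, h2⟩
        exact ⟨e, he, h1, fun t ht => (h2 t ht).imp_right fun h => hXY h⟩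

end WeakSimInstance

/-! ### Reading instances -/

namespace WeakSimInstance

/-- One step of reading a unary number. -/
def unaryStep (s : ℕ × List Γ') : ℕ × List Γ' :=
  bif eqb (s.2.headD .blank) (.bit true) then (s.1 + 1, s.2.tail) else s

/-- Read a unary number. -/
def takeUnary (w : List Γ') : ℕ × List Γ' :=
  ((unaryStep^[w.length] (0, w)).1, (unaryStep^[w.length] (0, w)).2.tail)

/-- One step of reading a word of bits. -/
def bitsStep (s : List Bool × List Γ') : List Bool × List Γ' :=
  bif eqb (s.2.headD .blank) (.bit true) then (true :: s.1, s.2.tail) else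
    bif eqb (s.2.headD .blank) (.bit false) then (false :: s.1, s.2.tail) else s

/-- Read a word of bits; the result is reversed. -/
def takeBits (w : List Γ') : List Bool × List Γ' :=
  ((bitsStep^[w.length] ([], w)).1, (bitsStep^[w.length] ([], w)).2.tail)

/-- Read the effect of a transition. -/
def takeEffect (w : List Γ') : SignType × List Γ' :=
  (bif eqb (w.headD .blank) (.bit true) then .pos else
    bif eqb (w.headD .blank) (.bit false) then .neg else .zero, w.tail)

/-- One step of reading a list. -/
def listStep {α : Type} (p : List Γ' → α × List Γ') (s : List α × List Γ') : List α × List Γ' :=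
  bif eqb (s.2.headD .blank) .bra then ((p s.2.tail).1 :: s.1, (p s.2.tail).2) else s

/-- Read a list. -/
def takeList {α : Type} (p : List Γ' → α × List Γ') (w : List Γ') : List α × List Γ' :=
  (((listStep p)^[w.length] ([], w)).1.reverse, ((listStep p)^[w.length] ([], w)).2.tail)

/-- Read a transition of a net. -/
def takeNetTrans (w : List Γ') : (ℕ × ℕ × SignType × ℕ) × List Γ' :=
  let a := takeUnary w
  let b := takeUnary a.2
  let c := takeEffect b.2
  let d := takeUnary c.2
  ((a.1, b.1, c.1, d.1), d.2)

/-- Read a transition of a finite system. -/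
def takeFinTrans (w : List Γ') : (ℕ × ℕ × ℕ) × List Γ' :=
  let a := takeUnary w
  let b := takeUnary a.2
  let c := takeUnary b.2
  ((a.1, b.1, c.1), c.2)

/-- The data of an instance, by numbers; the counter is given by its bits, the most significant
bit first. -/
abbrev Data : Type :=
  ℕ × ℕ × ℕ × ℕ × List Bool × ℕ × NetTransitions × FinTransitions

/-- Read an instance. -/
def parse (w : List Γ') : Data :=
  let a := takeUnary w
  let b := takeUnary a.2
  let c := takeUnary b.2
  let d := takeUnary c.2
  let e := takeBits d.2
  let f := takeUnary e.2
  let g := takeList takeNetTrans f.2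
  let h := takeList takeFinTrans g.2
  (a.1, b.1, c.1, d.1, e.1, f.1, g.1, h.1)

/-- The data of an instance. -/
def data (I : WeakSimInstance) : Data :=
  (I.numVisible, I.numNet, I.numFin, I.netState, (encodeNat I.counter).reverse, I.finState,
    I.netData, I.finData)

/-- The word that presents the data of an instance. -/
def write (J : Data) : List Γ' :=
  unaryCode J.1 ++ (unaryCode J.2.1 ++ (unaryCode J.2.2.1 ++ (unaryCode J.2.2.2.1 ++
    ((J.2.2.2.2.1.reverse.map Γ'.bit ++ [Γ'.comma]) ++ (unaryCode J.2.2.2.2.2.1 ++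
      (listCode (fun t : ℕ × ℕ × SignType × ℕ => unaryCode t.1 ++ (unaryCode t.2.1 ++
        (effectCode t.2.2.1 ++ unaryCode t.2.2.2))) J.2.2.2.2.2.2.1 ++
      listCode (fun t : ℕ × ℕ × ℕ => unaryCode t.1 ++ (unaryCode t.2.1 ++ unaryCode t.2.2))
        J.2.2.2.2.2.2.2))))))

/-- The numbers are in their ranges, and the counter value has no leading zeros. -/
def valid (J : Data) : Bool :=
  -- The default `true` admits the empty word of bits, which is the code of zero.
  Nat.blt J.2.2.2.1 J.2.1 && Nat.blt J.2.2.2.2.2.1 J.2.2.1 && J.2.2.2.2.1.headD true &&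
  (J.2.2.2.2.2.2.1.all fun t => Nat.blt t.1 J.2.1 && Nat.blt t.2.1 (J.1 + 1) &&
    Nat.blt t.2.2.2 J.2.1) &&
  (J.2.2.2.2.2.2.2.all fun t => Nat.blt t.1 J.2.2.1 && Nat.blt t.2.1 (J.1 + 1) &&
    Nat.blt t.2.2 J.2.2.1)

/-- The value of a word of bits, the most significant one first, capped at `B`. -/
def cappedValue (B : ℕ) (l : List Bool) : ℕ :=
  l.foldl (fun v b => min (v + v + bif b then 1 else 0) B) 0

/-- Spoiler wins from the initial position. -/
def spoilerWinsTest (J : Data) : Bool :=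
  (winList J.2.1 J.2.2.1 (J.2.1 * J.2.2.1 + 1) J.2.2.2.2.2.2.1 J.2.2.2.2.2.2.2
    (tauReach J.2.2.1 J.2.2.2.2.2.2.2)).any fun y =>
      eqb y (J.2.2.2.1, cappedValue (J.2.1 * J.2.2.1 + 1) J.2.2.2.2.1, J.2.2.2.2.2.1)

/-- The decision procedure. -/
def decideWord (w : List Γ') : Bool :=
  valid (parse w) && eqb (write (parse w)) w && !spoilerWinsTest (parse w)

/-! ### Reading is correct -/

/-- The readers iterate as often as the input is long, which is usually too often. This is harmless
because their steps do nothing once a terminator is reached. -/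
theorem iterate_of_fixed {α : Type} {f : α → α} {x y : α} {k n : ℕ} (h : f^[k] x = y)
    (hy : f y = y) (hk : k ≤ n) : f^[n] x = y := by
  obtain ⟨j, rfl⟩ := Nat.exists_eq_add_of_le' hk
  rw [Function.iterate_add_apply, h, Function.iterate_fixed hy]

theorem takeUnary_append (n : ℕ) (u : List Γ') : takeUnary (unaryCode n ++ u) = (n, u) := by
  have h : ∀ n k, unaryStep^[n] (k, unaryCode n ++ u) = (k + n, .comma :: u) := by
    intro n
    induction n with
    | zero => intro k; rfl
    | succ n ih =>
      intro k
      rw [Function.iterate_succ_apply, show unaryStep (k, unaryCode (n + 1) ++ u) =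
        (k + 1, unaryCode n ++ u) from rfl, ih]
      congr 1; omega
  have h' := iterate_of_fixed (n := (unaryCode n ++ u).length) (h n 0) rfl (by
    simp [unaryCode])
  rw [takeUnary, h']
  simp

theorem takeBits_append (l : List Bool) (u : List Γ') :
    takeBits ((l.map Γ'.bit ++ [Γ'.comma]) ++ u) = (l.reverse, u) := by
  have h : ∀ l k : List Bool, bitsStep^[l.length] (k, (l.map Γ'.bit ++ [Γ'.comma]) ++ u) =
      (l.reverse ++ k, .comma :: u) := by
    intro l
    induction l with
    | nil => intro k; rfl
    | cons b l ih =>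
      intro k
      rw [List.length_cons, Function.iterate_succ_apply,
        show bitsStep (k, ((b :: l).map Γ'.bit ++ [Γ'.comma]) ++ u) =
          (b :: k, (l.map Γ'.bit ++ [Γ'.comma]) ++ u) by cases b <;> rfl, ih]
      simp
  have h' := iterate_of_fixed (n := ((l.map Γ'.bit ++ [Γ'.comma]) ++ u).length) (h l []) rfl (by
    simp)
  rw [takeBits, h']
  simp

theorem takeEffect_append (d : SignType) (u : List Γ') :
    takeEffect (effectCode d ++ u) = (d, u) := by
  cases d <;> rfl

theorem takeList_append {α β : Type} {p : List Γ' → β × List Γ'} {c : α → List Γ'} {r : α → β}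
    (h : ∀ x u, p (c x ++ u) = (r x, u)) (l : List α) (u : List Γ') :
    takeList p (listCode c l ++ u) = (l.map r, u) := by
  have h1 : ∀ (l : List α) k, (listStep p)^[l.length] (k, listCode c l ++ u) =
      ((l.map r).reverse ++ k, .ket :: u) := by
    intro l
    induction l with
    | nil => intro k; rfl
    | cons x l ih =>
      intro k
      have h2 : listCode c (x :: l) ++ u = Γ'.bra :: (c x ++ (listCode c l ++ u)) := by
        simp [listCode]
      rw [List.length_cons, Function.iterate_succ_apply, h2,
        show listStep p (k, Γ'.bra :: (c x ++ (listCode c l ++ u))) =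
          ((p (c x ++ (listCode c l ++ u))).1 :: k, (p (c x ++ (listCode c l ++ u))).2) from rfl,
        h, ih]
      simp
  have h3 : l.length ≤ (listCode c l ++ u).length := by
    induction l with
    | nil => simp
    | cons x l ih => simp [listCode] at ih ⊢; omega
  have h' := iterate_of_fixed (h1 l []) rfl h3
  rw [takeList, h']
  simp

theorem parse_encode (I : WeakSimInstance) : parse I.encode = I.data := by
  have h1 : ∀ (x : Fin I.numNet × Fin (I.numVisible + 1) × SignType × Fin I.numNet) u,
      takeNetTrans (netTransCode x ++ u) = ((x.1.val, x.2.1.val, x.2.2.1, x.2.2.2.val), u) := by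
    intro x u
    simp only [takeNetTrans, netTransCode, List.append_assoc, takeUnary_append, takeEffect_append]
  have h2 : ∀ (x : Fin I.numFin × Fin (I.numVisible + 1) × Fin I.numFin) u,
      takeFinTrans (finTransCode x ++ u) = ((x.1.val, x.2.1.val, x.2.2.val), u) := by
    intro x u
    simp only [takeFinTrans, finTransCode, List.append_assoc, takeUnary_append]
  have h3 := takeList_append h2 I.finTrans []
  rw [List.append_nil] at h3
  simp only [parse, encode, takeUnary_append, binaryCode, takeBits_append, takeList_append h1, h3]
  rfl

theorem write_data (I : WeakSimInstance) : write I.data = I.encode := by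
  simp only [write, data, encode, List.reverse_reverse, binaryCode, netData, finData, listCode,
    List.flatMap_map]
  rfl

/-! ### Canonical binary codes and capped values -/

theorem encodePosNum_canonical (n : PosNum) : (encodePosNum n).getLast? = some true := by
  induction n with
  | one => rfl
  | bit0 n ih => rw [encodePosNum, List.getLast?_cons, ih]; rfl
  | bit1 n ih => rw [encodePosNum, List.getLast?_cons, ih]; rfl

theorem encodeNat_canonical (n : ℕ) : (encodeNat n).getLast?.getD true = true := by
  unfold encodeNat
  cases (n : Num) with
  | zero => rfl
  | pos n => rw [encodeNum, encodePosNum_canonical]; rfl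

theorem encode_decodePosNum (l : List Bool) (h : l.getLast? = some true) :
    encodePosNum (decodePosNum l) = l := by
  induction l with
  | nil => simp at h
  | cons b l ih =>
    rcases l with _ | ⟨c, l⟩
    · cases b
      · simp at h
      · rfl
    · rw [List.getLast?_cons_cons] at h
      cases b
      · rw [decodePosNum, encodePosNum, ih h]
      · rw [decodePosNum, if_neg (by simp), encodePosNum, ih h]

/-- Without leading zeros a binary representation is unique; the default in `getD` covers the empty
representation of zero. -/
theorem encode_decodeNat (l : List Bool) (h : l.getLast?.getD true = true) :
    encodeNat (decodeNat l) = l := by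
  unfold encodeNat decodeNat
  rw [Num.of_to_nat]
  cases l with
  | nil => rfl
  | cons b l =>
    have h' : (b :: l).getLast? = some true := by
      rw [List.getLast?_cons] at h ⊢
      simpa using h
    rw [decodeNum, if_neg (by simp), PosNum.cast_to_num]
    exact encode_decodePosNum _ h'

/-- Doubling and adding a bit never decreases a number, so once the cap is reached it stays reached,
and capping after every bit equals capping the final value. -/
theorem cappedValue_reverse_encodeNat (B n : ℕ) :
    cappedValue B (encodeNat n).reverse = min n B := by
  have h : ∀ p : PosNum, (encodePosNum p).foldr
      (fun b v => min (v + v + bif b then 1 else 0) B) 0 = min (p : ℕ) B := by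
    intro p
    induction p with
    | one => simp [encodePosNum]
    | bit0 p ih => rw [encodePosNum, List.foldr_cons, ih, PosNum.cast_bit0]; simp; omega
    | bit1 p ih => rw [encodePosNum, List.foldr_cons, ih, PosNum.cast_bit1]; simp; omega
  rw [cappedValue, List.foldl_reverse, encodeNat]
  conv_rhs => rw [← Num.to_of_nat n]
  cases (n : Num) with
  | zero => simp [encodeNum]
  | pos p => exact h p

theorem valid_data (I : WeakSimInstance) : valid I.data = true := by
  have h := encodeNat_canonical I.counter
  have h1 : ((encodeNat I.counter).reverse.headD true) = true := by
    rw [List.headD_eq_head?_getD, List.head?_reverse, h]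
  simp only [valid, data, h1, Bool.and_eq_true, Nat.blt_eq, Fin.is_lt, true_and, netData, finData,
    List.all_eq_true, List.mem_map]
  constructor
  · rintro _ ⟨x, -, rfl⟩
    exact ⟨⟨x.1.isLt, x.2.1.isLt⟩, x.2.2.2.isLt⟩
  · rintro _ ⟨x, -, rfl⟩
    exact ⟨⟨x.1.isLt, x.2.1.isLt⟩, x.2.2.isLt⟩

/-- The range checks are exactly what is needed to lift the numbers to `Fin`, and the absence of
leading zeros makes the bits the code of the number that they denote. -/
theorem exists_data_eq {J : Data} (h : valid J = true) : ∃ I : WeakSimInstance, I.data = J := by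
  obtain ⟨v, k, n, p, l, s, N, F⟩ := J
  simp only [valid, Bool.and_eq_true, Nat.blt_eq, List.all_eq_true] at h
  obtain ⟨⟨⟨⟨hp, hs⟩, hl⟩, hN⟩, hF⟩ := h
  have hN' : N ∈ Set.range (List.map fun t : Fin k × Fin (v + 1) × SignType × Fin k =>
      (t.1.val, t.2.1.val, t.2.2.1, t.2.2.2.val)) := by
    rw [Set.range_list_map]
    rintro ⟨q, a, d, q'⟩ hx
    obtain ⟨⟨h1, h2⟩, h3⟩ := hN _ hx
    exact ⟨(⟨q, h1⟩, ⟨a, h2⟩, d, ⟨q', h3⟩), rfl⟩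
  have hF' : F ∈ Set.range (List.map fun t : Fin n × Fin (v + 1) × Fin n =>
      (t.1.val, t.2.1.val, t.2.2.val)) := by
    rw [Set.range_list_map]
    rintro ⟨q, a, q'⟩ hx
    obtain ⟨⟨h1, h2⟩, h3⟩ := hF _ hx
    exact ⟨(⟨q, h1⟩, ⟨a, h2⟩, ⟨q', h3⟩), rfl⟩
  obtain ⟨N', rfl⟩ := hN'
  obtain ⟨F', rfl⟩ := hF'
  refine ⟨⟨v, k, n, ⟨p, hp⟩, decodeNat l.reverse, ⟨s, hs⟩, N', F'⟩, ?_⟩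
  have h1 : encodeNat (decodeNat l.reverse) = l.reverse := by
    refine encode_decodeNat _ ?_
    rwa [List.getLast?_reverse, ← List.headD_eq_head?_getD]
  simp only [data, h1, List.reverse_reverse, netData, finData]

theorem spoilerWinsTest_data (I : WeakSimInstance) : spoilerWinsTest I.data = true ↔ ¬ I.Holds := by
  rw [Holds, LTS.weaklySimulatedBy_iff, not_not,
    OneCounterNet.spoilerWins_iff_cappedWins (B := I.numNet * I.numFin + 1) (by simp),
    ← mem_winList_iff _ _ _ _ (min_le_right _ _), ← cappedValue_reverse_encodeNat]
  exact any_eqb_iff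

/-- The parser is total and returns arbitrary data on malformed words. Valid data come from an
instance, and comparing its code with the input accepts only genuine codes. -/
theorem mem_problem_iff (w : List Γ') : w ∈ problem ↔ decideWord w = true := by
  simp only [decideWord, Bool.and_eq_true, eqb_iff, Bool.not_eq_true', ← Bool.not_eq_true]
  constructor
  · rintro ⟨I, rfl, h⟩
    rw [parse_encode]
    exact ⟨⟨valid_data I, write_data I⟩, fun h' => (spoilerWinsTest_data I).1 h' h⟩
  · rintro ⟨⟨h1, h2⟩, h3⟩
    obtain ⟨I, hI⟩ := exists_data_eq h1
    rw [← hI] at h2 h3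
    rw [write_data] at h2
    rw [spoilerWinsTest_data, not_not] at h3
    exact ⟨I, h2, h3⟩

end WeakSimInstance

/-! ### The procedure takes polynomial time -/

namespace WeakSimInstance

/-- Since the readers leave a suffix of their input, the size of the unread part does not grow and
serves as the measure for `PolyTime.iterate_of_measure`. -/
theorem suffix_iterate {α β : Type} {f : α × List β → α × List β} (h : ∀ s, (f s).2 <:+ s.2)
    (n : ℕ) (s : α × List β) : (f^[n] s).2 <:+ s.2 := by
  induction n with
  | zero => exact List.suffix_rfl
  | succ n ih => rw [Function.iterate_succ_apply']; exact (h _).trans ih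

theorem unaryStep_suffix (s : ℕ × List Γ') : (unaryStep s).2 <:+ s.2 := by
  unfold unaryStep
  cases eqb (s.2.headD .blank) (.bit true)
  · exact List.suffix_rfl
  · exact List.tail_suffix _

theorem takeUnary_suffix (w : List Γ') : (takeUnary w).2 <:+ w :=
  (List.tail_suffix _).trans (suffix_iterate unaryStep_suffix w.length (0, w))

theorem takeNetTrans_suffix (w : List Γ') : (takeNetTrans w).2 <:+ w :=
  (takeUnary_suffix _).trans ((List.tail_suffix _).trans
    ((takeUnary_suffix _).trans (takeUnary_suffix _)))

theorem takeFinTrans_suffix (w : List Γ') : (takeFinTrans w).2 <:+ w :=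
  (takeUnary_suffix _).trans ((takeUnary_suffix _).trans (takeUnary_suffix _))

variable {α : Type} [TreeEnc α]

theorem _root_.PolyTime.takeUnary {f : α → List Γ'} (hf : PolyTime f) :
    PolyTime fun x => WeakSimInstance.takeUnary (f x) := by
  have hs : PolyTime unaryStep := by unfold unaryStep; fun_prop
  have h := PolyTime.iterate_of_measure (l := fun w : List Γ' => w) (g := fun w => (0, w))
    (by fun_prop) (by fun_prop) hs (fun s => size s.2) (.C 1)
    (fun s => by obtain ⟨n, w⟩ := s; rw [size_pair]; dsimp only; omega)
    (fun s => size_le_of_sublist (unaryStep_suffix s).sublist) (fun s => by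
      obtain ⟨n, w⟩ := s
      unfold unaryStep
      rcases w with _ | ⟨x, w⟩
      · exact Nat.le_add_right _ _
      · cases eqb ((x :: w).headD .blank) (.bit true)
        · exact Nat.le_add_right _ _
        · simp only [cond_true, List.tail_cons, size_pair, size_succ, size_cons, Polynomial.eval_C]
          omega)
  have h' : PolyTime WeakSimInstance.takeUnary := h.fst'.pair h.snd'.tail
  exact h'.comp hf

theorem _root_.PolyTime.takeBits {f : α → List Γ'} (hf : PolyTime f) :
    PolyTime fun x => WeakSimInstance.takeBits (f x) := by
  have hs : PolyTime bitsStep := by unfold bitsStep; fun_prop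
  have hb : ∀ s, (bitsStep s).2 <:+ s.2 ∧ size (bitsStep s) ≤ size s + 4 := by
    rintro ⟨n, w⟩
    have h1 : size w.tail ≤ size w := size_le_of_sublist (List.tail_sublist w)
    unfold bitsStep
    cases eqb (w.headD .blank) (.bit true)
    · cases eqb (w.headD .blank) (.bit false)
      · exact ⟨List.suffix_rfl, Nat.le_add_right _ _⟩
      · refine ⟨List.tail_suffix _, ?_⟩
        simp only [cond_true, cond_false, size_pair, size_cons, size_false]; omega
    · refine ⟨List.tail_suffix _, ?_⟩
      simp only [cond_true, size_pair, size_cons, size_true]; omega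
  have h := PolyTime.iterate_of_measure (l := fun w : List Γ' => w) (g := fun w => ([], w))
    (by fun_prop) (by fun_prop) hs (fun s => size s.2) 4
    (fun s => by obtain ⟨n, w⟩ := s; rw [size_pair]; dsimp only; omega)
    (fun s => size_le_of_sublist (hb s).1.sublist) (fun s => by
      rw [Polynomial.eval_ofNat]; exact (hb s).2)
  have h' : PolyTime WeakSimInstance.takeBits := h.fst'.pair h.snd'.tail
  exact h'.comp hf

theorem _root_.PolyTime.takeEffect {f : α → List Γ'} (hf : PolyTime f) :
    PolyTime fun x => WeakSimInstance.takeEffect (f x) := by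
  unfold WeakSimInstance.takeEffect; fun_prop

/-- An entry is read from the unread part, so its size is polynomial in the measure; the suffix
assumption on `p` keeps the measure from growing. -/
theorem _root_.PolyTime.takeList {β : Type} [TreeEnc β] {p : List Γ' → β × List Γ'}
    (hp : PolyTime p) (hs : ∀ w, (p w).2 <:+ w) {f : α → List Γ'} (hf : PolyTime f) :
    PolyTime fun x => WeakSimInstance.takeList p (f x) := by
  have ⟨_, q, hq⟩ := hp
  have hstep : PolyTime (listStep p) := by
    have h : PolyTime fun s : List β × List Γ' => p s.2.tail := hp.comp (by fun_prop)
    unfold listStep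
    exact .cond' (by fun_prop) (h.fst'.cons (by fun_prop) |>.pair h.snd') (by fun_prop)
  have hb : ∀ s, (listStep p s).2 <:+ s.2 ∧
      size (listStep p s) ≤ size s + (q + 1).eval (size s.2) := by
    rintro ⟨l, w⟩
    have h1 : (p w.tail).2 <:+ w := (hs _).trans (List.tail_suffix _)
    have h2 := (hq w.tail).1
    have h3 := q.eval_le_eval_nat (size_le_of_sublist (List.tail_sublist w))
    unfold listStep
    cases eqb (w.headD .blank) .bra
    · exact ⟨List.suffix_rfl, Nat.le_add_right _ _⟩
    · refine ⟨h1, ?_⟩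
      have h4 : size (p w.tail) = size (p w.tail).1 + size (p w.tail).2 + 1 := size_pair _ _
      simp only [cond_true, size_pair, size_cons, Polynomial.eval_add, Polynomial.eval_one]; omega
  have h := PolyTime.iterate_of_measure (l := fun w : List Γ' => w)
    (g := fun w => (([] : List β), w))
    (by fun_prop) (by fun_prop) hstep (fun s => size s.2) (q + 1)
    (fun s => by obtain ⟨n, w⟩ := s; rw [size_pair]; dsimp only; omega)
    (fun s => size_le_of_sublist (hb s).1.sublist) (fun s => (hb s).2)
  have h' : PolyTime (WeakSimInstance.takeList p) := h.fst'.reverse.pair h.snd'.tail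
  exact h'.comp hf

theorem polyTime_takeNetTrans : PolyTime takeNetTrans := by
  have a : PolyTime fun w => takeUnary w := .takeUnary .id
  have b := PolyTime.takeUnary a.snd'
  have c := PolyTime.takeEffect b.snd'
  have d := PolyTime.takeUnary c.snd'
  exact (a.fst'.pair (b.fst'.pair (c.fst'.pair d.fst'))).pair d.snd'

theorem polyTime_takeFinTrans : PolyTime takeFinTrans := by
  have a : PolyTime fun w => takeUnary w := .takeUnary .id
  have b := PolyTime.takeUnary a.snd'
  have c := PolyTime.takeUnary b.snd'
  exact (a.fst'.pair (b.fst'.pair c.fst')).pair c.snd'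

theorem polyTime_parse : PolyTime parse := by
  have a : PolyTime fun w => takeUnary w := .takeUnary .id
  have b := PolyTime.takeUnary a.snd'
  have c := PolyTime.takeUnary b.snd'
  have d := PolyTime.takeUnary c.snd'
  have e := PolyTime.takeBits d.snd'
  have f := PolyTime.takeUnary e.snd'
  have g := PolyTime.takeList polyTime_takeNetTrans takeNetTrans_suffix f.snd'
  have h := PolyTime.takeList polyTime_takeFinTrans takeFinTrans_suffix g.snd'
  exact a.fst'.pair (b.fst'.pair (c.fst'.pair (d.fst'.pair (e.fst'.pair (f.fst'.pair
    (g.fst'.pair h.fst'))))))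

@[fun_prop]
theorem _root_.PolyTime.unaryCode {f : α → ℕ} (hf : PolyTime f) :
    PolyTime fun x => WeakSimInstance.unaryCode (f x) := by
  unfold WeakSimInstance.unaryCode; fun_prop

@[fun_prop]
theorem _root_.PolyTime.effectCode {f : α → SignType} (hf : PolyTime f) :
    PolyTime fun x => WeakSimInstance.effectCode (f x) := by
  have h : PolyTime fun x => bif eqb (f x) .neg then [Γ'.bit false] else
    bif eqb (f x) .zero then [Γ'.comma] else [Γ'.bit true] := by fun_prop
  convert h using 2 with x
  cases f x <;> rfl

@[fun_prop]
theorem _root_.PolyTime.bit {f : α → Bool} (hf : PolyTime f) : PolyTime fun x => Γ'.bit (f x) := by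
  have h : PolyTime fun x => bif f x then Γ'.bit true else Γ'.bit false := by fun_prop
  convert h using 2 with x
  cases f x <;> rfl

theorem polyTime_write : PolyTime write := by
  unfold write listCode; fun_prop

theorem polyTime_valid : PolyTime valid := by
  unfold valid; fun_prop

@[fun_prop]
theorem _root_.PolyTime.cappedValue {B : α → ℕ} {l : α → List Bool} (hB : PolyTime B)
    (hl : PolyTime l) : PolyTime fun x => WeakSimInstance.cappedValue (B x) (l x) := by
  have h : PolyTime fun x : ℕ × List Bool => WeakSimInstance.cappedValue x.1 x.2 :=
    PolyTime.foldl (f := fun (x : ℕ × List Bool) v b => min (v + v + bif b then 1 else 0) x.1)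
      -- The new accumulator never exceeds the cap, which belongs to the context, so the polynomial
      -- `X` is enough.
      (l := fun x => x.2) (g := fun _ => 0) (by fun_prop) (by fun_prop) (by fun_prop) .X (by
        rintro ⟨B, l⟩ v b
        simp only [Polynomial.eval_X, size_pair, size_nat]; omega)
  exact h.comp (hB.pair hl)

/-- The numbers of states are given in unary, so the cap and the list of all positions have
polynomial size. -/
theorem polyTime_spoilerWinsTest : PolyTime spoilerWinsTest := by
  have h : PolyTime fun J : Data => winList J.2.1 J.2.2.1 (J.2.1 * J.2.2.1 + 1) J.2.2.2.2.2.2.1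
      J.2.2.2.2.2.2.2 (tauReach J.2.2.1 J.2.2.2.2.2.2.2) :=
    .winList (by fun_prop) (by fun_prop) (by fun_prop) (by fun_prop) (by fun_prop)
      (.tauReach (by fun_prop) (by fun_prop))
  exact .any h (by fun_prop)

theorem polyTime_decideWord : PolyTime decideWord :=
  (((polyTime_valid.comp polyTime_parse).and ((polyTime_write.comp polyTime_parse).eqb .id)).and
    (polyTime_spoilerWinsTest.comp polyTime_parse).not)

end WeakSimInstance

theorem mainTheorem6 : InP WeakSimInstance.problem :=
  WeakSimInstance.polyTime_decideWord.inP WeakSimInstance.mem_problem_iff
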